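/- Let $E$ be an elliptic curve over $\mathbb{Q}$, let $\pi\colon E\to L\cong\mathbb{P}^1_{\mathbb{Q}}$ be the quotient of $E$ by the involution $[-1]$ (the $x$-coordinate map of a Weierstrass equation), and let $\mathcal{E}\to L$ be the self-twist of $E$, that is, the quadratic twist of the constant group scheme $E_L=E\times L$ by the double cover $\pi$: for every $L$-scheme $T$, $\mathcal{E}(T)$ is the group (under pointwise addition) of morphisms $\varphi\colon T\times_L E\to E$ over $\mathbb{Q}$ which are odd, meaning that $\varphi\circ(\mathrm{id}_T\times[-1])=[-1]\circ\varphi$. Let $\gamma\colon L\to\mathcal{E}$ be the canonical section, corresponding to $\mathrm{id}_E$; thus, for $\xi\in L(\mathbb{Q})$, $\gamma(\xi)\in\mathcal{E}_\xi(\mathbb{Q})$ is the odd morphism given by the inclusion $\pi^{-1}(\xi)\hookrightarrow E$. Then for all but finitely many $\xi\in L(\mathbb{Q})$, the fibre $\mathcal{E}_\xi$ of $\mathcal{E}$ at $\xi$ is an elliptic curve over $\mathbb{Q}$, and $\gamma(\xi)\in\mathcal{E}_\xi(\mathbb{Q})$ has infinite order. In particular, every elliptic curve over $\mathbb{Q}$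 has a quadratic twist with positive rank: if $y^2=f(x)$, with $f\in\mathbb{Q}[x]$ a monic cubic polynomial, is an equation of $E$ obtained by completing the square, then there is a non-square $d\in\mathbb{Q}^\times$ such that the elliptic curve $d\,y^2=f(x)$ has positive rank over $\mathbb{Q}$. -/

import Mathlib

open scoped WeierstrassCurve

namespace SelfTwist

/-- An `R`-valued point of projective space with homogeneous coordinates indexed by `Fin n`: a line
in `R ^ n`, that is, a direct summand of rank one. Such submodules are exactly those in which any
two vectors are proportional (all `2 × 2` minors vanish) and whose vectors have coordinates that
generate the unit ideal: where the coordinate `v i` of a vector `v` of the submodule is invertible,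
the submodule is freely generated by the unimodular vector `v`. -/
@[ext]
structure ProjPoint (n : ℕ) (R : Type) [CommRing R] where
  line : Submodule R (Fin n → R)
  minors : ∀ v ∈ line, ∀ w ∈ line, ∀ i j, v i * w j = v j * w i
  unimodular : Ideal.span {r : R | ∃ v ∈ line, ∃ i, v i = r} = ⊤

/-- To prove that an element of `R` vanishes it is enough to kill it by the `k`-th powers of
all coordinates of all vectors of a line. -/
lemma ProjPoint.eq_zero_of_pow_mul {n : ℕ} {R : Type} [CommRing R] (p : ProjPoint n R) (k : ℕ)
    (x : R) (h : ∀ v ∈ p.line, ∀ i, v i ^ k * x = 0) : x = 0 := by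
  have h1 := Ideal.span_pow_eq_top _ p.unimodular k
  have h2 : Ideal.span ((fun y => y ^ k) '' {r : R | ∃ v ∈ p.line, ∃ i, v i = r}) ≤
      LinearMap.ker (LinearMap.toSpanSingleton R R x) := by
    rw [Ideal.span_le]
    rintro _ ⟨_, ⟨v, hv, i, rfl⟩, rfl⟩
    simpa using h v hv i
  have h3 := h2 (h1 ▸ Submodule.mem_top : (1 : R) ∈ _)
  simpa using h3

/-- A line which contains another line is equal to it. -/
lemma ProjPoint.eq_of_le {n : ℕ} {R : Type} [CommRing R] {p p' : ProjPoint n R}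
    (h : p.line ≤ p'.line) : p = p' := by
  ext1
  refine le_antisymm h fun w hw => ?_
  have h2 : Ideal.span {r : R | ∃ v ∈ p.line, ∃ i, v i = r} ≤
      p.line.comap (LinearMap.toSpanSingleton R (Fin n → R) w) := by
    rw [Ideal.span_le]
    rintro _ ⟨v, hv, i, rfl⟩
    have hvw : v i • w = w i • v := by
      ext j
      have := p'.minors v (h hv) w hw i j
      simp only [Pi.smul_apply, smul_eq_mul]
      linear_combination this
    simpa [hvw] using p.line.smul_mem (w i) hv
  have h3 := h2 (p.unimodular ▸ Submodule.mem_top : (1 : R) ∈ _)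
  simpa using h3

/-- If a line is given by generators, it suffices to check the two conditions on these. -/
def ProjPoint.ofSpan {n : ℕ} {R : Type} [CommRing R] (s : Set (Fin n → R))
    (hm : ∀ v ∈ s, ∀ w ∈ s, ∀ i j, v i * w j = v j * w i)
    (hu : Ideal.span {r : R | ∃ v ∈ s, ∃ i, v i = r} = ⊤) : ProjPoint n R where
  line := Submodule.span R s
  minors := by
    intro v hv w hw i j
    induction hv, hw using Submodule.span_induction₂ with
    | mem_mem x y hx hy => exact hm x hx y hy i j
    | zero_left y hy => simp
    | zero_right x hx => simp
    | add_left x y z hx hy hz h₁ h₂ => simp only [Pi.add_apply]; linear_combination h₁ + h₂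
    | add_right x y z hx hy hz h₁ h₂ => simp only [Pi.add_apply]; linear_combination h₁ + h₂
    | smul_left r x y hx hy h =>
      simp only [Pi.smul_apply, smul_eq_mul]; linear_combination r * h
    | smul_right r x y hx hy h =>
      simp only [Pi.smul_apply, smul_eq_mul]; linear_combination r * h
  unimodular := by
    refine top_le_iff.mp (hu ▸ Ideal.span_mono ?_)
    rintro r ⟨v, hv, i, rfl⟩
    exact ⟨v, Submodule.subset_span hv, i, rfl⟩

/-- Base change of a point of projective space along a ring homomorphism. -/
def ProjPoint.map {n : ℕ} {R S : Type} [CommRing R] [CommRing S] (f : R →+* S)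
    (p : ProjPoint n R) : ProjPoint n S :=
  .ofSpan {w | ∃ v ∈ p.line, w = f ∘ v}
    (by
      rintro _ ⟨v, hv, rfl⟩ _ ⟨w, hw, rfl⟩ i j
      simp only [Function.comp_apply, ← map_mul, p.minors v hv w hw i j])
    (by
      have h := congrArg (Ideal.map f) p.unimodular
      rw [Ideal.map_span, Ideal.map_top] at h
      refine top_le_iff.mp (h ▸ Ideal.span_mono ?_)
      rintro _ ⟨_, ⟨v, hv, i, rfl⟩, rfl⟩
      exact ⟨f ∘ v, ⟨v, hv, rfl⟩, i, rfl⟩)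

lemma ProjPoint.map_map {n : ℕ} {R S T : Type} [CommRing R] [CommRing S] [CommRing T]
    (f : R →+* S) (g : S →+* T) (p : ProjPoint n R) : (p.map f).map g = p.map (g.comp f) := by
  refine (ProjPoint.eq_of_le (Submodule.span_le.mpr ?_)).symm
  rintro _ ⟨v, hv, rfl⟩
  exact Submodule.subset_span ⟨f ∘ v, Submodule.subset_span ⟨v, hv, rfl⟩, rfl⟩

/-- The functor of points of the projective plane cubic over `ℚ` given by a Weierstrass equation:
`CurvePoint E R` is `E(R)`, for a `ℚ`-algebra `R`. -/
@[ext]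
structure CurvePoint (E : WeierstrassCurve ℚ) (R : Type) [CommRing R] [Algebra ℚ R]
    extends ProjPoint 3 R where
  equation : ∀ v ∈ line, (E⁄R).toProjective.Equation v

/-- If generators of a line satisfy a Weierstrass equation, then so does the whole line. -/
lemma ProjPoint.equation_of_span {R : Type} [CommRing R] (W : WeierstrassCurve R)
    (s : Set (Fin 3 → R)) (hm : ∀ v ∈ s, ∀ w ∈ s, ∀ i j, v i * w j = v j * w i)
    (hu : Ideal.span {r : R | ∃ v ∈ s, ∃ i, v i = r} = ⊤)
    (hs : ∀ v ∈ s, W.toProjective.Equation v) :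
    ∀ v ∈ (ProjPoint.ofSpan s hm hu).line, W.toProjective.Equation v := by
  intro v hv
  rw [WeierstrassCurve.Projective.equation_iff]
  have h1 := Ideal.span_pow_eq_top _ hu 3
  set x := v 1 ^ 2 * v 2 + W.a₁ * v 0 * v 1 * v 2 + W.a₃ * v 1 * v 2 ^ 2
      - (v 0 ^ 3 + W.a₂ * v 0 ^ 2 * v 2 + W.a₄ * v 0 * v 2 ^ 2 + W.a₆ * v 2 ^ 3) with hx
  have h2 : Ideal.span ((fun y => y ^ 3) '' {r : R | ∃ v ∈ s, ∃ i, v i = r}) ≤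
      LinearMap.ker (LinearMap.toSpanSingleton R R x) := by
    rw [Ideal.span_le]
    rintro _ ⟨_, ⟨w, hw, i, rfl⟩, rfl⟩
    have hE := (WeierstrassCurve.Projective.equation_iff w).mp (hs w hw)
    have hp : ∀ j, w i * v j = v i * w j := fun j => by
      have := (ProjPoint.ofSpan s hm hu).minors v hv w (Submodule.subset_span hw) i j
      linear_combination -this
    have key : w i ^ 3 * x = v i ^ 3 * 0 := by
      rw [← hE, hx]
      calc _ = (w i * v 1) ^ 2 * (w i * v 2) + W.a₁ * (w i * v 0) * (w i * v 1) * (w i * v 2)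
            + W.a₃ * (w i * v 1) * (w i * v 2) ^ 2
            - ((w i * v 0) ^ 3 + W.a₂ * (w i * v 0) ^ 2 * (w i * v 2)
              + W.a₄ * (w i * v 0) * (w i * v 2) ^ 2 + W.a₆ * (w i * v 2) ^ 3) := by ring
        _ = _ := by rw [hp 0, hp 1, hp 2]; ring
    simpa using key
  have h3 := h2 (h1 ▸ Submodule.mem_top : (1 : R) ∈ _)
  simpa using h3

namespace CurvePoint

variable {E : WeierstrassCurve ℚ} {R S : Type} [CommRing R] [Algebra ℚ R] [CommRing S] [Algebra ℚ S]

/-- Functoriality of `E(R)` in the `ℚ`-algebra `R`. -/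
def map (f : R →ₐ[ℚ] S) (e : CurvePoint E R) : CurvePoint E S where
  toProjPoint := e.toProjPoint.map (f : R →+* S)
  equation := by
    refine ProjPoint.equation_of_span _ _ _ _ ?_
    rintro _ ⟨v, hv, rfl⟩
    have h := WeierstrassCurve.Projective.Equation.map (f : R →+* S) (e.equation v hv)
    have h' : (E⁄R).map (f : R →+* S) = E⁄S := E.map_baseChange f
    exact h' ▸ h

/-- The inversion `[-1]` of `E`, which is `(X : Y : Z) ↦ (X : -Y - a₁ X - a₃ Z : Z)`. -/
def neg (e : CurvePoint E R) : CurvePoint E R :=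
  have hm : ∀ v ∈ {w | ∃ v ∈ e.line, w = (E⁄R).toProjective.neg v},
      ∀ w ∈ {w | ∃ v ∈ e.line, w = (E⁄R).toProjective.neg v}, ∀ i j, v i * w j = v j * w i := by
    rintro _ ⟨v, hv, rfl⟩ _ ⟨w, hw, rfl⟩ i j
    have h01 := e.minors v hv w hw 0 1
    have h02 := e.minors v hv w hw 0 2
    have h12 := e.minors v hv w hw 1 2
    fin_cases i <;> fin_cases j <;>
      simp only [WeierstrassCurve.Projective.neg, WeierstrassCurve.Projective.negY,
        Fin.zero_eta, Fin.mk_one, Fin.reduceFinMk, Matrix.cons_val] <;> grind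
  have hu : Ideal.span {r : R | ∃ v ∈ {w | ∃ v ∈ e.line, w = (E⁄R).toProjective.neg v},
      ∃ i, v i = r} = ⊤ := by
    refine top_le_iff.mp (e.unimodular ▸ Ideal.span_le.mpr ?_)
    rintro _ ⟨v, hv, i, rfl⟩
    set I := Ideal.span {r : R | ∃ v ∈ {w | ∃ v ∈ e.line, w = (E⁄R).toProjective.neg v},
      ∃ i, v i = r} with hI
    have h : ∀ j, (E⁄R).toProjective.neg v j ∈ I := fun j =>
      Ideal.subset_span ⟨_, ⟨v, hv, rfl⟩, j, rfl⟩
    have h0 : v 0 ∈ I := h 0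
    have h2 : v 2 ∈ I := h 2
    have h1 : -v 1 - (E⁄R).a₁ * v 0 - (E⁄R).a₃ * v 2 ∈ I := h 1
    fin_cases i
    · exact h0
    · have h3 := I.add_mem (I.add_mem h1 (I.mul_mem_left (E⁄R).a₁ h0))
        (I.mul_mem_left (E⁄R).a₃ h2)
      have h4 := I.neg_mem h3
      ring_nf at h4
      exact h4
    · exact h2
  { toProjPoint := .ofSpan {w | ∃ v ∈ e.line, w = (E⁄R).toProjective.neg v} hm hu
    equation := by
      refine ProjPoint.equation_of_span _ _ hm hu ?_
      rintro _ ⟨v, hv, rfl⟩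
      have h := (WeierstrassCurve.Projective.equation_iff v).mp (e.equation v hv)
      rw [WeierstrassCurve.Projective.equation_iff]
      simp only [WeierstrassCurve.Projective.neg, WeierstrassCurve.Projective.negY,
        Matrix.cons_val]
      linear_combination h }

/-- The origin `(0 : 1 : 0)` of `E`. -/
def origin (E : WeierstrassCurve ℚ) (R : Type) [CommRing R] [Algebra ℚ R] : CurvePoint E R :=
  have hm : ∀ v ∈ ({![0, 1, 0]} : Set (Fin 3 → R)), ∀ w ∈ ({![0, 1, 0]} : Set (Fin 3 → R)),
      ∀ i j, v i * w j = v j * w i := by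
    rintro _ rfl _ rfl i j; ring
  have hu : Ideal.span {r : R | ∃ v ∈ ({![0, 1, 0]} : Set (Fin 3 → R)), ∃ i, v i = r} = ⊤ :=
    (Ideal.eq_top_iff_one _).mpr (Ideal.subset_span ⟨_, rfl, 1, rfl⟩)
  { toProjPoint := .ofSpan {![0, 1, 0]} hm hu
    equation := by
      refine ProjPoint.equation_of_span _ _ hm hu ?_
      rintro _ rfl
      exact WeierstrassCurve.Projective.equation_zero }

/-- The point `(x : y : 1)` of `E` for a solution `(x, y)` of the affine equation. -/
def ofAffine {x y : R} (h : (E⁄R).toAffine.Equation x y) : CurvePoint E R :=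
  have hm : ∀ v ∈ ({![x, y, 1]} : Set (Fin 3 → R)), ∀ w ∈ ({![x, y, 1]} : Set (Fin 3 → R)),
      ∀ i j, v i * w j = v j * w i := by
    rintro _ rfl _ rfl i j; ring
  have hu : Ideal.span {r : R | ∃ v ∈ ({![x, y, 1]} : Set (Fin 3 → R)), ∃ i, v i = r} = ⊤ :=
    (Ideal.eq_top_iff_one _).mpr (Ideal.subset_span ⟨_, rfl, 2, rfl⟩)
  { toProjPoint := .ofSpan {![x, y, 1]} hm hu
    equation := by
      refine ProjPoint.equation_of_span _ _ hm hu ?_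
      rintro _ rfl
      exact (WeierstrassCurve.Projective.equation_some x y).mpr h }

/-- For a field `K`, the bijection from Mathlib's group of `K`-points to `E(K)`. -/
def ofPoint {K : Type} [Field K] [Algebra ℚ K] : (E⁄K).toAffine.Point → CurvePoint E K
  | .zero => origin E K
  | .some _ _ h => ofAffine h.1

/-- The quotient map `π : E → L = ℙ¹` of `E` by `[-1]`, the `x`-coordinate, which sends the
origin to `(1 : 0)`. Where the vector `(X, Z)` is not unimodular, the image is given by the second
expression: the equation of `E` is `Z (Y² + a₁XY + a₃YZ - a₂X² - a₄XZ - a₆Z²) = X³`. -/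
def toLine (e : CurvePoint E R) : ProjPoint 2 R :=
  .ofSpan {u | ∃ v ∈ e.line, u = ![v 0, v 2] ∨
      u = ![v 1 ^ 2 + (E⁄R).a₁ * v 0 * v 1 + (E⁄R).a₃ * v 1 * v 2 - (E⁄R).a₂ * v 0 ^ 2
        - (E⁄R).a₄ * v 0 * v 2 - (E⁄R).a₆ * v 2 ^ 2, v 0 ^ 2]}
    (by
      set q : (Fin 3 → R) → R := fun v => v 1 ^ 2 + (E⁄R).a₁ * v 0 * v 1 + (E⁄R).a₃ * v 1 * v 2
        - (E⁄R).a₂ * v 0 ^ 2 - (E⁄R).a₄ * v 0 * v 2 - (E⁄R).a₆ * v 2 ^ 2 with hq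
      have hqE : ∀ v ∈ e.line, v 2 * q v = v 0 ^ 3 := fun v hv => by
        have h := (WeierstrassCurve.Projective.equation_iff v).mp (e.equation v hv)
        linear_combination h
      have hqp : ∀ v ∈ e.line, ∀ w ∈ e.line, ∀ i, w i ^ 2 * q v = v i ^ 2 * q w := by
        intro v hv w hw i
        have hp : ∀ j, w i * v j = v i * w j := fun j => by
          linear_combination -(e.minors v hv w hw i j)
        calc w i ^ 2 * q v = (w i * v 1) ^ 2 + (E⁄R).a₁ * (w i * v 0) * (w i * v 1)
              + (E⁄R).a₃ * (w i * v 1) * (w i * v 2) - (E⁄R).a₂ * (w i * v 0) ^ 2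
              - (E⁄R).a₄ * (w i * v 0) * (w i * v 2) - (E⁄R).a₆ * (w i * v 2) ^ 2 := by
              simp only [hq]; ring
          _ = _ := by rw [hp 0, hp 1, hp 2]; simp only [hq]; ring
      have h00 : ∀ v ∈ e.line, ∀ w ∈ e.line, v 0 * w 0 ^ 2 = v 2 * q w := by
        intro v hv w hw
        rw [← sub_eq_zero]
        refine e.eq_zero_of_pow_mul 3 _ fun u hu i => ?_
        have hp : ∀ j, u i * v j = v i * u j := fun j => by
          linear_combination -(e.minors v hv u hu i j)
        have hp' : ∀ j, u i * w j = w i * u j := fun j => by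
          linear_combination -(e.minors w hw u hu i j)
        calc u i ^ 3 * (v 0 * w 0 ^ 2 - v 2 * q w)
            = (u i * v 0) * (u i * w 0) ^ 2 - (u i * v 2) * (u i ^ 2 * q w) := by ring
          _ = v i * w i ^ 2 * (u 0 ^ 3 - u 2 * q u) := by
              rw [hp 0, hp' 0, hp 2, hqp w hw u hu i]; ring
          _ = 0 := by rw [hqE u hu]; ring
      have h11 : ∀ v ∈ e.line, ∀ w ∈ e.line, q v * w 0 ^ 2 = v 0 ^ 2 * q w := fun v hv w hw => by
        linear_combination hqp v hv w hw 0
      simp only [hq] at h00 h11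
      rintro _ ⟨v, hv, rfl | rfl⟩ _ ⟨w, hw, rfl | rfl⟩ i j <;> fin_cases i <;> fin_cases j <;>
        simp only [Fin.zero_eta, Fin.mk_one, Matrix.cons_val]
      all_goals first
        | ring1
        | exact e.minors v hv w hw 0 2
        | exact e.minors v hv w hw 2 0
        | linear_combination h00 v hv w hw
        | linear_combination -(h00 v hv w hw)
        | linear_combination h00 w hw v hv
        | linear_combination -(h00 w hw v hv)
        | linear_combination h11 v hv w hw
        | linear_combination -(h11 v hv w hw))
    (by
      set I := Ideal.span {r : R | ∃ u ∈ {u : Fin 2 → R | ∃ v ∈ e.line, u = ![v 0, v 2] ∨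
        u = ![v 1 ^ 2 + (E⁄R).a₁ * v 0 * v 1 + (E⁄R).a₃ * v 1 * v 2 - (E⁄R).a₂ * v 0 ^ 2
          - (E⁄R).a₄ * v 0 * v 2 - (E⁄R).a₆ * v 2 ^ 2, v 0 ^ 2]}, ∃ i, u i = r} with hI
      rw [← Ideal.radical_eq_top, ← top_le_iff, ← e.unimodular, Ideal.span_le]
      rintro _ ⟨v, hv, i, rfl⟩
      have h0 : v 0 ∈ I := Ideal.subset_span ⟨_, ⟨v, hv, .inl rfl⟩, 0, rfl⟩
      have h2 : v 2 ∈ I := Ideal.subset_span ⟨_, ⟨v, hv, .inl rfl⟩, 1, rfl⟩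
      have hq : v 1 ^ 2 + (E⁄R).a₁ * v 0 * v 1 + (E⁄R).a₃ * v 1 * v 2 - (E⁄R).a₂ * v 0 ^ 2
          - (E⁄R).a₄ * v 0 * v 2 - (E⁄R).a₆ * v 2 ^ 2 ∈ I :=
        Ideal.subset_span ⟨_, ⟨v, hv, .inr rfl⟩, 0, rfl⟩
      have h1 : v 1 ^ 2 ∈ I := by
        have h := I.add_mem (I.add_mem hq (I.mul_mem_left
          (-(E⁄R).a₁ * v 1 + (E⁄R).a₂ * v 0 + (E⁄R).a₄ * v 2) h0))
          (I.mul_mem_left (-(E⁄R).a₃ * v 1 + (E⁄R).a₆ * v 2) h2)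
        ring_nf at h
        exact h
      fin_cases i
      · exact Ideal.le_radical h0
      · exact ⟨2, h1⟩
      · exact Ideal.le_radical h2)

/-- The map `π` is a morphism: it is compatible with base change. -/
lemma toLine_map (f : R →ₐ[ℚ] S) (e : CurvePoint E R) :
    (e.map f).toLine = e.toLine.map (f : R →+* S) := by
  refine (ProjPoint.eq_of_le (Submodule.span_le.mpr ?_)).symm
  rintro _ ⟨u, hu, rfl⟩
  change u ∈ Submodule.span R _ at hu
  induction hu using Submodule.span_induction with
  | mem x hx =>
    obtain ⟨v, hv, rfl | rfl⟩ := hx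
    · refine Submodule.subset_span ⟨f ∘ v, Submodule.subset_span ⟨v, hv, rfl⟩, .inl ?_⟩
      ext i; fin_cases i <;> simp
    · refine Submodule.subset_span ⟨f ∘ v, Submodule.subset_span ⟨v, hv, rfl⟩, .inr ?_⟩
      ext i; fin_cases i <;> simp [WeierstrassCurve.baseChange]
  | zero =>
    have h : (((f : R →+* S) : R → S) ∘ (0 : Fin 2 → R)) = 0 := by ext; simp
    rw [h]; exact Submodule.zero_mem _
  | add x y _ _ hx hy =>
    have h : ((f : R →+* S) : R → S) ∘ (x + y) = (f : R →+* S) ∘ x + (f : R →+* S) ∘ y := by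
      ext; simp
    rw [h]; exact Submodule.add_mem _ hx hy
  | smul r x _ hx =>
    have h : ((f : R →+* S) : R → S) ∘ (r • x) = f r • ((f : R →+* S) ∘ x) := by ext; simp
    rw [h]; exact Submodule.smul_mem _ _ hx

/-- The map `π` is invariant under `[-1]`. -/
lemma toLine_neg (e : CurvePoint E R) : e.neg.toLine = e.toLine := by
  refine (ProjPoint.eq_of_le (Submodule.span_le.mpr ?_)).symm
  rintro _ ⟨v, hv, rfl | rfl⟩
  · exact Submodule.subset_span ⟨_, Submodule.subset_span ⟨v, hv, rfl⟩, .inl rfl⟩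
  · refine Submodule.subset_span ⟨_, Submodule.subset_span ⟨v, hv, rfl⟩, .inr ?_⟩
    ext i
    fin_cases i
    · simp only [WeierstrassCurve.Projective.neg, WeierstrassCurve.Projective.negY,
        Fin.zero_eta, Matrix.cons_val]
      ring
    · rfl

/-- If `e` lies over `t`, then its base change lies over the base change of `t`. -/
lemma toLine_map_eq {T : Type} [CommRing T] [Algebra ℚ T] {t : ProjPoint 2 T} {f : T →ₐ[ℚ] R}
    {e : CurvePoint E R} (h : e.toLine = t.map (f : T →+* R)) (g : R →ₐ[ℚ] S) :
    (e.map g).toLine = t.map (g.comp f : T →+* S) := by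
  rw [toLine_map, h, ProjPoint.map_map]; rfl

end CurvePoint

/-- The self-twist `𝓔 → L` of `E`, as a functor: for a `ℚ`-algebra `R` and a point `t ∈ L(R)`, that
is, an affine `L`-scheme `T = Spec R`, this is the set of `T`-valued points of `𝓔` over `L`. By
definition of the quadratic twist of `E_L` by the double cover `π : E → L`, it is the set of odd
`L`-morphisms from `T̃ = T ×_L E` to `E_L = E × L`, or equivalently of odd `ℚ`-morphisms
`T ×_L E → E`. Such a morphism is given by its effect on points with values in `ℚ`-algebras `S`, and
an `S`-valued point of `T ×_L E` is a pair of `f : Spec S → T` and `e ∈ E(S)` with `π(e) = t ∘ f`.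
The involution of `T ×_L E` is induced by the involution `[-1]` of `E`. -/
@[ext]
structure Twist (E : WeierstrassCurve ℚ) (R : Type) [CommRing R] [Algebra ℚ R]
    (t : ProjPoint 2 R) where
  app : ∀ (S : Type) [CommRing S] [Algebra ℚ S] (f : R →ₐ[ℚ] S) (e : CurvePoint E S),
    e.toLine = t.map (f : R →+* S) → CurvePoint E S
  natural : ∀ (S S' : Type) [CommRing S] [Algebra ℚ S] [CommRing S'] [Algebra ℚ S']
    (f : R →ₐ[ℚ] S) (g : S →ₐ[ℚ] S') (e : CurvePoint E S)
    (h : e.toLine = t.map (f : R →+* S)),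
    app S' (g.comp f) (e.map g) (CurvePoint.toLine_map_eq h g) = (app S f e h).map g
  odd : ∀ (S : Type) [CommRing S] [Algebra ℚ S] (f : R →ₐ[ℚ] S) (e : CurvePoint E S)
    (h : e.toLine = t.map (f : R →+* S)),
    app S f e.neg ((CurvePoint.toLine_neg e).trans h) = (app S f e h).neg

/-- The restriction map of `𝓔` along a morphism `Spec R' → Spec R` over `L`. -/
def Twist.pullback {E : WeierstrassCurve ℚ} {R R' : Type} [CommRing R] [Algebra ℚ R]
    [CommRing R'] [Algebra ℚ R'] {t : ProjPoint 2 R} {t' : ProjPoint 2 R'} (g : R →ₐ[ℚ] R')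
    (ht : t.map (g : R →+* R') = t') (φ : Twist E R t) : Twist E R' t' where
  app S _ _ f e h := φ.app S (f.comp g) e (by
    rw [h, ← ht, ProjPoint.map_map]; rfl)
  natural S S' _ _ _ _ f k e _ := φ.natural S S' (f.comp g) k e _
  odd S _ _ f e _ := φ.odd S (f.comp g) e _

/-- The canonical section `γ : L → 𝓔`, which corresponds to the identity of `E`. Its value at a point
`t` is the projection `T ×_L E → E`; for `t = ξ ∈ L(ℚ)` it is the inclusion of `π⁻¹(ξ)` in `E`. -/
def canonicalSection (E : WeierstrassCurve ℚ) (R : Type) [CommRing R] [Algebra ℚ R]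
    (t : ProjPoint 2 R) : Twist E R t where
  app _ _ _ _ e _ := e
  natural _ _ _ _ _ _ _ _ _ _ := rfl
  odd _ _ _ _ _ _ := rfl

/-- The point of `L(R)` induced by a rational point `ξ` of `L`. -/
abbrev const (ξ : ProjPoint 2 ℚ) (R : Type) [CommRing R] [Algebra ℚ R] : ProjPoint 2 R :=
  ξ.map (algebraMap ℚ R)

lemma map_const (ξ : ProjPoint 2 ℚ) {R R' : Type} [CommRing R] [Algebra ℚ R] [CommRing R']
    [Algebra ℚ R'] (g : R →ₐ[ℚ] R') : (const ξ R).map (g : R →+* R') = const ξ R' := by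
  rw [ProjPoint.map_map, AlgHom.comp_algebraMap]

/-- The fibre `𝓔_ξ` of the self-twist at a rational point `ξ` of `L`, as a functor: its points with
values in a `ℚ`-algebra `R`. It is the twist of `E` by the double cover `π⁻¹(ξ)` of `Spec ℚ`. -/
abbrev Fibre (E : WeierstrassCurve ℚ) (ξ : ProjPoint 2 ℚ) (R : Type) [CommRing R] [Algebra ℚ R] :
    Type 1 :=
  Twist E R (const ξ R)

open scoped Classical in
/-- The data exhibiting the fibre `𝓔_ξ` as an elliptic curve over `ℚ`: a smooth Weierstrass cubic
`curve` and an isomorphism of functors (hence of schemes over `ℚ`) from it to `𝓔_ξ`, which takes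
the origin to the zero of `𝓔_ξ` (the constant morphism to the origin of `E`) and the group law of
the cubic to the group law of `𝓔_ξ` (pointwise addition of morphisms to `E`). The last condition is
stated on points with values in fields, which suffices because the varieties involved are reduced;
on these the group law of a Weierstrass cubic is the one of Mathlib. -/
structure EllipticModel (E : WeierstrassCurve ℚ) (ξ : ProjPoint 2 ℚ) where
  curve : WeierstrassCurve ℚ
  isElliptic : curve.IsElliptic
  equiv : ∀ (R : Type) [CommRing R] [Algebra ℚ R], CurvePoint curve R ≃ Fibre E ξ R
  natural : ∀ (R R' : Type) [CommRing R] [Algebra ℚ R] [CommRing R'] [Algebra ℚ R']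
    (g : R →ₐ[ℚ] R') (p : CurvePoint curve R),
    equiv R' (p.map g) = (equiv R p).pullback g (map_const ξ g)
  map_origin : ∀ (R S : Type) [CommRing R] [Algebra ℚ R] [CommRing S] [Algebra ℚ S]
    (f : R →ₐ[ℚ] S) (e : CurvePoint E S) (h : e.toLine = (const ξ R).map (f : R →+* S)),
    (equiv R (.origin curve R)).app S f e h = .origin E S
  map_add : ∀ (K F : Type) [Field K] [Algebra ℚ K] [Field F] [Algebra ℚ F] (f : K →ₐ[ℚ] F)
    (e : CurvePoint E F) (h : e.toLine = (const ξ K).map (f : K →+* F))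
    (P Q : (curve⁄K).toAffine.Point) (p q : (E⁄F).toAffine.Point),
    (equiv K (.ofPoint P)).app F f e h = .ofPoint p →
    (equiv K (.ofPoint Q)).app F f e h = .ofPoint q →
    (equiv K (.ofPoint (P + Q))).app F f e h = .ofPoint (p + q)

/-- The quadratic twist of `E` by `d`: completing the square in the equation of `E` gives
`y² = f(x)` with `f = x³ + (b₂/4) x² + (b₄/2) x + b₆/4`, and this is the curve `d y² = f(x)` in the
coordinates `(d x, d² y)`. -/
def quadraticTwist (E : WeierstrassCurve ℚ) (d : ℚ) : WeierstrassCurve ℚ where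
  a₁ := 0
  a₂ := d * E.b₂ / 4
  a₃ := 0
  a₄ := d ^ 2 * E.b₄ / 2
  a₆ := d ^ 3 * E.b₆ / 4

end SelfTwist

/-! For ξ = (x : 1), the fibre of π is the double cover δ² = D, where δ = 2y + a₁x + a₃ and D is
`fibreDisc E x`. If D ≠ 0, the fibre of the self-twist at ξ is the quadratic twist of E by D, and
the canonical section becomes its rational point P = (Dx, D²/2), whose x-coordinate read on E is x
itself.

Infinite order comes from heights. On the x-line of E, doubling is the same rational map of degree 4
for every twist, so one bound B serves for all D: once h(x) > B, the double is not the origin and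
its x-coordinate has larger height (`exists_logHeight_lt_duplication`). The points 2ⁿP then have
strictly increasing heights, so P is not torsion (`exists_not_isOfFinAddOrder`). By Northcott only
finitely many x have h(x) ≤ B; these and (1 : 0) contain all exceptions.

The identification of the fibre is functorial. A point p of the twist gives the odd morphism that
untwists p along the square root δ(e) attached to each point e over x (`toFibre`). Conversely, an
odd morphism is determined by its value at the universal point over R[√D]; oddness makes the
corresponding point of the twist invariant under conjugation, so it descends to R
(`toFibre_surjective`). The group laws are compared on field points (`IsShortModel.toPoint_add`).

For the last claim, x is taken very negative, so that D < 0 is not a square. -/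

open scoped QuadraticAlgebra

namespace SelfTwist

/-! ### Heights and doubling on quadratic twists -/

open Height WeierstrassCurve

/-- Away from a set of bounded height, the `x`-coordinate of the double of a point is defined and
has larger height than the `x`-coordinate of the point. -/
lemma exists_logHeight_lt_duplication (E : WeierstrassCurve ℚ) [E.IsElliptic] :
    ∃ B : ℝ, ∀ x : ℚ, B < logHeight₁ x →
      4 * x ^ 3 + E.b₂ * x ^ 2 + 2 * E.b₄ * x + E.b₆ ≠ 0 ∧
      logHeight₁ x < logHeight₁ ((x ^ 4 - E.b₄ * x ^ 2 - 2 * E.b₆ * x - E.b₈) /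
        (4 * x ^ 3 + E.b₂ * x ^ 2 + 2 * E.b₄ * x + E.b₆)) := by
  obtain ⟨C₁, h₁⟩ := abs_logHeight_addSubMap_sub_two_mul_logHeight_le E
  obtain ⟨C₂, h₂⟩ := logHeight_sym2_ge ℚ
  -- The two height estimates give h(F : G : 0) ≥ 4 h(x) + 2 C₂ - C₁. This exceeds 3 h(x) once h(x)
  -- > C₁ - 2 C₂, and h(x) > 0 then gives 3 h(x) > h(x).
  refine ⟨max 0 (C₁ - 2 * C₂), fun x hx => ?_⟩
  have hx0 := (le_max_left 0 (C₁ - 2 * C₂)).trans_lt hx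
  have hx1 := (le_max_right 0 (C₁ - 2 * C₂)).trans_lt hx
  set F := x ^ 4 - E.b₄ * x ^ 2 - 2 * E.b₆ * x - E.b₈ with hF
  set G := 4 * x ^ 3 + E.b₂ * x ^ 2 + 2 * E.b₄ * x + E.b₆ with hG
  have hne : ![x, 1] ≠ (0 : Fin 2 → ℚ) := fun h => one_ne_zero (congrFun h 1)
  have k1 := h₁ ![x * x, x * 1 + 1 * x, 1 * 1]
  have k2 := h₂ hne hne
  -- `addSubMap` takes the unordered pair x(P), x(Q) to the pair x(P + Q), x(P - Q). For P = Q the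
  -- latter is (F : G), (1 : 0), with symmetric functions (F : G : 0).
  have hmap : (fun i ↦ (addSubMap E i).eval ![x * x, x * 1 + 1 * x, 1 * 1]) = ![F, G, 0] := by
    ext i
    fin_cases i <;> simp [addSubMap, hF, hG] <;> ring
  rw [hmap] at k1
  rw [← logHeight₁_eq_logHeight] at k2
  have key : 3 * logHeight₁ x < logHeight ![F, G, 0] := by
    have := (abs_le.mp k1).1
    linarith
  -- If G vanished, (F : 0 : 0) would have height 0, against the lower bound 3 h(x) > 0.
  have hG0 : G ≠ 0 := by
    intro h0
    rw [h0] at key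
    have : logHeight ![F, 0, 0] = 0 := by
      rw [logHeight_eq_log_mulHeight]
      simp [mulHeight_eq_one_of_subsingleton]
    linarith
  refine ⟨hG0, ?_⟩
  have : logHeight ![F, G, 0] = logHeight₁ (F / G) := by
    rw [logHeight₁_div_eq_logHeight, logHeight_eq_log_mulHeight, logHeight_eq_log_mulHeight]
    simp
  linarith

variable {E : WeierstrassCurve ℚ} {D : ℚ}

lemma quadraticTwist_Δ : (quadraticTwist E D).Δ = D ^ 6 * E.Δ := by
  simp only [WeierstrassCurve.Δ, WeierstrassCurve.b₂, WeierstrassCurve.b₄, WeierstrassCurve.b₆,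
    WeierstrassCurve.b₈, quadraticTwist]
  ring

lemma quadraticTwist_isElliptic [E.IsElliptic] (hD : D ≠ 0) : (quadraticTwist E D).IsElliptic := by
  rw [isElliptic_iff, quadraticTwist_Δ]
  exact (IsUnit.mk0 _ (pow_ne_zero 6 hD)).mul E.isUnit_Δ

lemma quadraticTwist_equation_iff {X Y : ℚ} :
    (quadraticTwist E D).toAffine.Equation X Y ↔
      4 * Y ^ 2 = 4 * X ^ 3 + D * E.b₂ * X ^ 2 + 2 * D ^ 2 * E.b₄ * X + D ^ 3 * E.b₆ := by
  rw [Affine.equation_iff]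
  simp only [quadraticTwist]
  constructor <;> intro h
  · linear_combination 4 * h
  · linear_combination h / 4

/-- Doubling a point of a quadratic twist, in terms of the `x`-coordinate on the original curve. -/
lemma quadraticTwist_double (hD : D ≠ 0) {X Y : ℚ}
    (h : (quadraticTwist E D).toAffine.Nonsingular X Y)
    (hG : 4 * (X / D) ^ 3 + E.b₂ * (X / D) ^ 2 + 2 * E.b₄ * (X / D) + E.b₆ ≠ 0) :
    ∃ (X' Y' : ℚ) (h' : (quadraticTwist E D).toAffine.Nonsingular X' Y'),
      2 • Affine.Point.some X Y h = Affine.Point.some X' Y' h' ∧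
      X' / D = ((X / D) ^ 4 - E.b₄ * (X / D) ^ 2 - 2 * E.b₆ * (X / D) - E.b₈) /
        (4 * (X / D) ^ 3 + E.b₂ * (X / D) ^ 2 + 2 * E.b₄ * (X / D) + E.b₆) := by
  have he := quadraticTwist_equation_iff.mp h.1
  -- At X = Dx the equation of the twist reads 4Y² = D³ G(x), so G(x) ≠ 0 says that the point is not
  -- 2-torsion.
  have hYG : 4 * (X / D) ^ 3 + E.b₂ * (X / D) ^ 2 + 2 * E.b₄ * (X / D) + E.b₆ =
      4 * Y ^ 2 / D ^ 3 := by
    rw [he]; field_simp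
  have hY : Y ≠ 0 := by
    rintro rfl
    exact hG (by rw [hYG]; simp)
  have hneg : Y ≠ (quadraticTwist E D).toAffine.negY X Y := by
    simp only [Affine.negY, quadraticTwist]
    intro h
    exact hY (by linarith)
  refine ⟨_, _, _, (two_nsmul _).trans (Affine.Point.add_self_of_Y_ne hneg), ?_⟩
  rw [hYG, Affine.slope_of_Y_ne rfl hneg]
  simp only [Affine.addX, Affine.negY, quadraticTwist]
  have h2 : Y - (-Y - 0 * X - 0) = 2 * Y := by ring
  rw [h2]
  field_simp
  have hb8 : 4 * E.b₈ = E.b₂ * E.b₆ - E.b₄ ^ 2 := E.b_relation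
  grind

/-- A point of a quadratic twist whose `x`-coordinate, on the original curve, has large height is of
infinite order. -/
lemma exists_not_isOfFinAddOrder (E : WeierstrassCurve ℚ) [E.IsElliptic] :
    ∃ B : ℝ, ∀ x : ℚ, B < logHeight₁ x →
      4 * x ^ 3 + E.b₂ * x ^ 2 + 2 * E.b₄ * x + E.b₆ ≠ 0 ∧
      ∀ (D : ℚ) (_ : D ≠ 0) (X Y : ℚ) (h : (quadraticTwist E D).toAffine.Nonsingular X Y),
        X / D = x → ¬ IsOfFinAddOrder (Affine.Point.some X Y h) := by
  obtain ⟨B, hB⟩ := exists_logHeight_lt_duplication E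
  refine ⟨B, fun x hx => ⟨(hB x hx).1, fun D hD X Y h hX hfin => ?_⟩⟩
  let W := quadraticTwist E D
  -- The value 0 at the origin is a convention that plays no role: the induction below also carries
  -- that the multiples are nonzero.
  let ht : W.toAffine.Point → ℝ := fun P => P.casesOn 0 fun X _ _ => logHeight₁ (X / D)
  have hstep : ∀ P : W.toAffine.Point, P ≠ 0 → B < ht P → 2 • P ≠ 0 ∧ ht P < ht (2 • P) := by
    rintro (_ | ⟨X, Y, h⟩) h0 hP
    · exact absurd rfl h0
    · obtain ⟨hG, hlt⟩ := hB (X / D) hP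
      obtain ⟨X', Y', h', h2, hX'⟩ := quadraticTwist_double hD h hG
      rw [h2]
      refine ⟨Affine.Point.some_ne_zero _, ?_⟩
      change logHeight₁ (X / D) < logHeight₁ (X' / D)
      rwa [hX']
  have hind : ∀ n : ℕ, 2 ^ n • Affine.Point.some X Y h ≠ 0 ∧
      B < ht (2 ^ n • Affine.Point.some X Y h) := by
    intro n
    induction n with
    | zero =>
      rw [pow_zero, one_nsmul]
      exact ⟨Affine.Point.some_ne_zero _, by change B < logHeight₁ (X / D); rwa [hX]⟩
    | succ n ih =>
      rw [pow_succ, mul_nsmul]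
      have := hstep _ ih.1 ih.2
      exact ⟨this.1, ih.2.trans this.2⟩
  have hmono : StrictMono fun n : ℕ => ht (2 ^ n • Affine.Point.some X Y h) := by
    refine strictMono_nat_of_lt_succ fun n => ?_
    rw [pow_succ, mul_nsmul]
    exact (hstep _ (hind n).1 (hind n).2).2
  have hinj : Function.Injective fun n : ℕ => 2 ^ n • Affine.Point.some X Y h :=
    Function.Injective.of_comp (f := ht) hmono.injective
  refine Set.infinite_range_of_injective hinj ((finite_multiples.mpr hfin).subset ?_)
  rintro _ ⟨n, rfl⟩
  exact ⟨2 ^ n, rfl⟩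

/-! ### Galois descent along R → R[√a] -/

section Descent

variable {R : Type} [CommRing R] {n : ℕ}

/-- A vector lies in a line as soon as it is so after multiplication by a unit. -/
lemma ProjPoint.mem_line_of_smul_mem (p : ProjPoint n R) {c : R} (hc : IsUnit c) {v : Fin n → R}
    (h : c • v ∈ p.line) : v ∈ p.line := by
  obtain ⟨u, rfl⟩ := hc
  simpa [smul_smul] using p.line.smul_mem (↑u⁻¹ : R) h

lemma ProjPoint.comp_mem_map {S : Type} [CommRing S] (f : R →+* S) (p : ProjPoint n R)
    {v : Fin n → R} (hv : v ∈ p.line) : f ∘ v ∈ (p.map f).line :=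
  Submodule.subset_span ⟨v, hv, rfl⟩

/-- Base change along `R → R[√a]` is injective on points of projective space. -/
lemma ProjPoint.map_quadratic_injective (a : R) :
    Function.Injective (ProjPoint.map (n := n) (algebraMap R (QuadraticAlgebra R a 0))) := by
  intro p p' h
  refine ProjPoint.eq_of_le fun v hv => ?_
  have h1 : algebraMap R (QuadraticAlgebra R a 0) ∘ v ∈
      (p'.map (algebraMap R (QuadraticAlgebra R a 0))).line := h ▸ p.comp_mem_map _ hv
  -- R[√a] is free over R on 1 and ω, so both components of an R[√a]-combination of vectors of `p'`
  -- stay in `p'`.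
  have h2 : ∀ u ∈ (p'.map (algebraMap R (QuadraticAlgebra R a 0))).line,
      (fun i => (u i).re) ∈ p'.line ∧ (fun i => (u i).im) ∈ p'.line := by
    intro u hu
    change u ∈ Submodule.span _ _ at hu
    induction hu using Submodule.span_induction with
    | mem x hx =>
      obtain ⟨w, hw, rfl⟩ := hx
      refine ⟨by simpa using hw, ?_⟩
      have : (fun i => ((algebraMap R (QuadraticAlgebra R a 0) ∘ w) i).im) = 0 := by ext; simp
      rw [this]; exact zero_mem _
    | zero => exact ⟨p'.line.zero_mem, p'.line.zero_mem⟩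
    | add x y _ _ hx hy => exact ⟨p'.line.add_mem hx.1 hy.1, p'.line.add_mem hx.2 hy.2⟩
    | smul r x _ hx =>
      constructor
      · have : (fun i => ((r • x) i).re) =
            r.re • (fun i => (x i).re) + (a * r.im) • (fun i => (x i).im) := by
          ext i; simp
        rw [this]
        exact p'.line.add_mem (p'.line.smul_mem r.re hx.1) (p'.line.smul_mem (a * r.im) hx.2)
      · have : (fun i => ((r • x) i).im) =
            r.re • (fun i => (x i).im) + r.im • (fun i => (x i).re) := by
          ext i; simp
        rw [this]
        exact p'.line.add_mem (p'.line.smul_mem r.re hx.2) (p'.line.smul_mem r.im hx.1)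
  simpa using (h2 _ h1).1

/-- Conjugation on `R[√a]`. -/
def conj (a : R) : QuadraticAlgebra R a 0 →ₐ[R] QuadraticAlgebra R a 0 :=
  QuadraticAlgebra.lift ⟨-.omega, by ext <;> simp⟩

@[simp] lemma re_conj (a : R) (z : QuadraticAlgebra R a 0) : (conj a z).re = z.re := by
  simp [conj, QuadraticAlgebra.lift]

@[simp] lemma im_conj (a : R) (z : QuadraticAlgebra R a 0) : (conj a z).im = -z.im := by
  simp [conj, QuadraticAlgebra.lift]

/-- The components of the vectors in a line over `R[√a]` which is stable under conjugation. -/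
lemma ProjPoint.re_im_mem_of_conj {a : R} (ha : IsUnit a) (h2 : IsUnit (2 : R))
    (p : ProjPoint n (QuadraticAlgebra R a 0))
    (hp : p.map (conj a : QuadraticAlgebra R a 0 →+* QuadraticAlgebra R a 0) = p)
    {v : Fin n → QuadraticAlgebra R a 0} (hv : v ∈ p.line) :
    (algebraMap R (QuadraticAlgebra R a 0) ∘ fun i => (v i).re) ∈ p.line ∧
    (algebraMap R (QuadraticAlgebra R a 0) ∘ fun i => (v i).im) ∈ p.line := by
  have hv' : (conj a : QuadraticAlgebra R a 0 →+* QuadraticAlgebra R a 0) ∘ v ∈ p.line := by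
    have := p.comp_mem_map (conj a : QuadraticAlgebra R a 0 →+* QuadraticAlgebra R a 0) hv
    rwa [hp] at this
  constructor
  · refine p.mem_line_of_smul_mem (h2.map (algebraMap R (QuadraticAlgebra R a 0))) ?_
    convert! p.line.add_mem hv hv' using 1
    ext i <;> simp [two_mul]
  -- Since ω² = a, ω times the difference of v and its conjugate is 2a times the ω-component of v;
  -- hence `a` must be a unit.
  · refine p.mem_line_of_smul_mem ((h2.mul ha).map (algebraMap R (QuadraticAlgebra R a 0))) ?_
    convert! p.line.smul_mem (.omega) (p.line.sub_mem hv hv') using 1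
    ext i <;> simp; ring

lemma algebraMap_quadratic_injective (a : R) :
    Function.Injective (algebraMap R (QuadraticAlgebra R a 0)) := fun x y h => by
  simpa using congrArg QuadraticAlgebra.re h

/-- Galois descent along `R → R[√a]` for points of projective space. -/
lemma ProjPoint.exists_map_quadratic {a : R} (ha : IsUnit a) (h2 : IsUnit (2 : R))
    (p : ProjPoint n (QuadraticAlgebra R a 0))
    (hp : p.map (conj a : QuadraticAlgebra R a 0 →+* QuadraticAlgebra R a 0) = p) :
    ∃ q : ProjPoint n R, q.map (algebraMap R (QuadraticAlgebra R a 0)) = p ∧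
      ∀ v ∈ q.line, algebraMap R (QuadraticAlgebra R a 0) ∘ v ∈ p.line := by
  have hinj := algebraMap_quadratic_injective a
  let L : Submodule R (Fin n → R) :=
    (p.line.restrictScalars R).comap
      ((Algebra.linearMap R (QuadraticAlgebra R a 0)).compLeft (Fin n))
  have hre : ∀ v ∈ p.line, (fun i => (v i).re) ∈ L := fun v hv =>
    (p.re_im_mem_of_conj ha h2 hp hv).1
  have him : ∀ v ∈ p.line, (fun i => (v i).im) ∈ L := fun v hv =>
    (p.re_im_mem_of_conj ha h2 hp hv).2
  let q : ProjPoint n R :=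
    { line := L
      minors := fun v hv w hw i j => hinj <| by
        rw [map_mul, map_mul]
        exact p.minors _ hv _ hw i j
      unimodular := by
        set I := Ideal.span {r : R | ∃ v ∈ L, ∃ i, v i = r}
        -- `J` is the extension of `I`. It contains all coordinates of vectors of `p`, hence 1,
        -- whose R-component then lies in `I`.
        let J : Ideal (QuadraticAlgebra R a 0) :=
          { carrier := {s | s.re ∈ I ∧ s.im ∈ I}
            add_mem' := fun hx hy => ⟨I.add_mem hx.1 hy.1, I.add_mem hx.2 hy.2⟩
            zero_mem' := ⟨I.zero_mem, I.zero_mem⟩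
            smul_mem' := fun c x hx => by
              refine ⟨I.add_mem (I.mul_mem_left _ hx.1) (I.mul_mem_left _ hx.2), ?_⟩
              refine I.add_mem (I.add_mem (I.mul_mem_left _ hx.2) (I.mul_mem_left _ hx.1))
                (I.mul_mem_left _ hx.2) }
        have hJ : (1 : QuadraticAlgebra R a 0) ∈ J := by
          have : Ideal.span {r | ∃ v ∈ p.line, ∃ i, v i = r} ≤ J := by
            rw [Ideal.span_le]
            rintro _ ⟨v, hv, i, rfl⟩
            exact ⟨Ideal.subset_span ⟨_, hre v hv, i, rfl⟩, Ideal.subset_span ⟨_, him v hv, i, rfl⟩⟩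
          exact this (p.unimodular ▸ Submodule.mem_top)
        exact (Ideal.eq_top_iff_one _).mpr hJ.1 }
  refine ⟨q, ProjPoint.eq_of_le (Submodule.span_le.mpr ?_), fun v hv => hv⟩
  rintro _ ⟨v, hv, rfl⟩
  exact hv

end Descent

namespace CurvePoint

variable {E : WeierstrassCurve ℚ} {R S T : Type} [CommRing R] [Algebra ℚ R] [CommRing S]
  [Algebra ℚ S] [CommRing T] [Algebra ℚ T]

lemma eq_of_le {p p' : CurvePoint E R} (h : p.line ≤ p'.line) : p = p' :=
  CurvePoint.ext (congrArg ProjPoint.line (ProjPoint.eq_of_le h))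

lemma toProjPoint_injective :
    Function.Injective (CurvePoint.toProjPoint : CurvePoint E R → ProjPoint 3 R) :=
  fun _ _ h => CurvePoint.ext (congrArg ProjPoint.line h)

lemma map_map (f : R →ₐ[ℚ] S) (g : S →ₐ[ℚ] T) (e : CurvePoint E R) :
    (e.map f).map g = e.map (g.comp f) :=
  toProjPoint_injective (ProjPoint.map_map _ _ _)

variable (R) in
/-- The inclusion of `R` in `R[√a]`, as a homomorphism of `ℚ`-algebras. -/
abbrev quadraticIncl (a : R) : R →ₐ[ℚ] QuadraticAlgebra R a 0 :=
  IsScalarTower.toAlgHom ℚ R (QuadraticAlgebra R a 0)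

lemma map_quadratic_injective (a : R) :
    Function.Injective (map (E := E) (quadraticIncl R a)) := fun _ _ h =>
  toProjPoint_injective <| ProjPoint.map_quadratic_injective a <| congrArg toProjPoint h

/-- Galois descent along `R → R[√a]` for points of a plane cubic. -/
lemma exists_map_quadratic {a : R} (ha : IsUnit a) (p : CurvePoint E (QuadraticAlgebra R a 0))
    (hp : p.map ((conj a).restrictScalars ℚ) = p) :
    ∃ q : CurvePoint E R, q.map (quadraticIncl R a) = p := by
  have h2 : IsUnit (2 : R) := by
    have := (IsUnit.mk0 (2 : ℚ) two_ne_zero).map (algebraMap ℚ R)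
    rwa [map_ofNat] at this
  obtain ⟨q, hq, hmem⟩ := p.toProjPoint.exists_map_quadratic ha h2 (congrArg toProjPoint hp)
  refine ⟨⟨q, fun v hv => ?_⟩, toProjPoint_injective hq⟩
  have h := p.equation _ (hmem v hv)
  have hmap : (E⁄R).map (algebraMap R (QuadraticAlgebra R a 0)) = E⁄(QuadraticAlgebra R a 0) :=
    E.map_baseChange (quadraticIncl R a)
  rw [← hmap] at h
  exact (WeierstrassCurve.Projective.map_equation (W' := (E⁄R).toProjective)
    (algebraMap_quadratic_injective a) v).mp h

end CurvePoint

/-! ### Identifying the twist with E by a square root of D -/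

/-- A line is determined by any one of its vectors with an invertible coordinate. -/
lemma ProjPoint.eq_of_mem {n : ℕ} {R : Type} [CommRing R] {p p' : ProjPoint n R} {u : Fin n → R}
    {i : Fin n} (hi : IsUnit (u i)) (hu : u ∈ p.line) (hu' : u ∈ p'.line) : p = p' := by
  refine ProjPoint.eq_of_le fun v hv => p'.mem_line_of_smul_mem hi ?_
  have : u i • v = v i • u := by
    ext j
    simp only [Pi.smul_apply, smul_eq_mul]
    linear_combination p.minors u hu v hv i j
  rw [this]
  exact p'.line.smul_mem _ hu'

/-- The image of a line under an automorphism of `R ^ n`. -/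
def ProjPoint.mapLinear {n : ℕ} {R : Type} [CommRing R] (A : (Fin n → R) ≃ₗ[R] (Fin n → R))
    (p : ProjPoint n R) : ProjPoint n R where
  line := p.line.map (A : (Fin n → R) →ₗ[R] (Fin n → R))
  minors := by
    rintro _ ⟨v, hv, rfl⟩ _ ⟨w, hw, rfl⟩ i j
    set B : Fin n → Fin n → R := fun k => A fun j => if k = j then 1 else 0
    have hA : ∀ v i, A v i = ∑ k, v k * B k i := fun v i => by
      have := LinearMap.pi_apply_eq_sum_univ (A : (Fin n → R) →ₗ[R] (Fin n → R)) v
      simpa using congrFun this i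
    simp only [LinearEquiv.coe_coe]
    rw [hA v i, hA w j, hA v j, hA w i, Finset.sum_mul_sum, Finset.sum_mul_sum, Finset.sum_comm]
    refine Finset.sum_congr rfl fun k _ => Finset.sum_congr rfl fun l _ => ?_
    linear_combination (B l i * B k j) * p.minors v hv w hw l k
  unimodular := by
    refine top_le_iff.mp (p.unimodular ▸ Ideal.span_le.mpr ?_)
    rintro _ ⟨v, hv, i, rfl⟩
    have h : v i = (A.symm : (Fin n → R) →ₗ[R] (Fin n → R)) (A v) i := by simp
    rw [h, LinearMap.pi_apply_eq_sum_univ, Finset.sum_apply]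
    refine Ideal.sum_mem _ fun k _ => ?_
    rw [Pi.smul_apply, smul_eq_mul]
    exact Ideal.mul_mem_right _ _ (Ideal.subset_span ⟨A v, ⟨v, hv, rfl⟩, k, rfl⟩)

lemma two_mul_half {S : Type} [CommRing S] [Algebra ℚ S] : 2 * algebraMap ℚ S (1 / 2) = 1 := by
  rw [← map_ofNat (algebraMap ℚ S) 2, ← map_mul]; norm_num

section Untwist

variable (E : WeierstrassCurve ℚ) {D : ℚ} {S S' : Type} [CommRing S] [Algebra ℚ S] [CommRing S']
  [Algebra ℚ S']

/-- The linear automorphism which, for a square root `δ` of `D`, identifies the quadratic twist of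
`E` by `D` with `E`. -/
def untwistLinear (hD : D ≠ 0) {δ : S} (hδ : δ ^ 2 = algebraMap ℚ S D) :
    (Fin 3 → S) ≃ₗ[S] (Fin 3 → S) where
  -- This is x = X/δ², y = Y/δ³ - (a₁x + a₃)/2, homogenized and multiplied by δ⁴ = D². The inverse
  -- uses D⁻¹δ for δ⁻¹.
  toFun v := ![algebraMap ℚ S D * v 0,
    δ * v 1 - algebraMap ℚ S (1 / 2) * algebraMap ℚ S E.a₁ * algebraMap ℚ S D * v 0 - algebraMap ℚ S (1 / 2) * algebraMap ℚ S E.a₃ * algebraMap ℚ S D ^ 2 * v 2,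
    algebraMap ℚ S D ^ 2 * v 2]
  map_add' v w := by ext i; fin_cases i <;> simp <;> ring
  map_smul' c v := by ext i; fin_cases i <;> simp <;> ring
  invFun w := ![algebraMap ℚ S D⁻¹ * w 0,
    algebraMap ℚ S D⁻¹ * δ * (w 1 + algebraMap ℚ S (1 / 2) * algebraMap ℚ S E.a₁ * w 0 + algebraMap ℚ S (1 / 2) * algebraMap ℚ S E.a₃ * w 2),
    algebraMap ℚ S D⁻¹ ^ 2 * w 2]
  left_inv v := by
    have h1 : algebraMap ℚ S D * algebraMap ℚ S D⁻¹ = 1 := by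
      rw [← map_mul, mul_inv_cancel₀ hD, map_one]
    ext i
    fin_cases i <;> simp <;> grind
  right_inv v := by
    have h1 : algebraMap ℚ S D * algebraMap ℚ S D⁻¹ = 1 := by
      rw [← map_mul, mul_inv_cancel₀ hD, map_one]
    ext i
    fin_cases i <;> simp <;> grind

lemma untwistLinear_apply (hD : D ≠ 0) {δ : S} (hδ : δ ^ 2 = algebraMap ℚ S D) (v : Fin 3 → S) :
    untwistLinear E hD hδ v = ![algebraMap ℚ S D * v 0,
      δ * v 1 - algebraMap ℚ S (1 / 2) * algebraMap ℚ S E.a₁ * algebraMap ℚ S D * v 0 - algebraMap ℚ S (1 / 2) * algebraMap ℚ S E.a₃ * algebraMap ℚ S D ^ 2 * v 2,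
      algebraMap ℚ S D ^ 2 * v 2] := rfl

/-- The substitution turns the equation of E into D³ times that of the twist, and D is a unit in
every ℚ-algebra. -/
lemma equation_untwistLinear_iff (hD : D ≠ 0) {δ : S} (hδ : δ ^ 2 = algebraMap ℚ S D)
    (v : Fin 3 → S) : (E⁄S).toProjective.Equation (untwistLinear E hD hδ v) ↔
      ((quadraticTwist E D)⁄S).toProjective.Equation v := by
  rw [WeierstrassCurve.Projective.equation_iff, WeierstrassCurve.Projective.equation_iff,
    untwistLinear_apply]
  have hu : IsUnit (algebraMap ℚ S D ^ 3) := ((IsUnit.mk0 D hD).map (algebraMap ℚ S)).pow 3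
  have h2 : 2 * algebraMap ℚ S (1 / 2) = 1 := two_mul_half
  have d2 : algebraMap ℚ S (D * E.b₂ / 4) = algebraMap ℚ S D *
      (algebraMap ℚ S (1 / 2) ^ 2 * algebraMap ℚ S E.a₁ ^ 2 + algebraMap ℚ S E.a₂) := by
    simp only [← map_mul, ← map_pow, ← map_add, WeierstrassCurve.b₂]; congr 1; ring
  have d4 : algebraMap ℚ S (D ^ 2 * E.b₄ / 2) = algebraMap ℚ S D ^ 2 *
      (algebraMap ℚ S (1 / 2) * algebraMap ℚ S E.a₁ * algebraMap ℚ S E.a₃ +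
        algebraMap ℚ S E.a₄) := by
    simp only [← map_mul, ← map_pow, ← map_add, WeierstrassCurve.b₄]; congr 1; ring
  have d6 : algebraMap ℚ S (D ^ 3 * E.b₆ / 4) = algebraMap ℚ S D ^ 3 *
      (algebraMap ℚ S (1 / 2) ^ 2 * algebraMap ℚ S E.a₃ ^ 2 + algebraMap ℚ S E.a₆) := by
    simp only [← map_mul, ← map_pow, ← map_add, WeierstrassCurve.b₆]; congr 1; ring
  have e1 : ((quadraticTwist E D)⁄S).a₁ = 0 := map_zero _
  have e2 : ((quadraticTwist E D)⁄S).a₂ = _ := d2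
  have e3 : ((quadraticTwist E D)⁄S).a₃ = 0 := map_zero _
  have e4 : ((quadraticTwist E D)⁄S).a₄ = _ := d4
  have e6 : ((quadraticTwist E D)⁄S).a₆ = _ := d6
  have f1 : (E⁄S).a₁ = algebraMap ℚ S E.a₁ := rfl
  have f2 : (E⁄S).a₂ = algebraMap ℚ S E.a₂ := rfl
  have f3 : (E⁄S).a₃ = algebraMap ℚ S E.a₃ := rfl
  have f4 : (E⁄S).a₄ = algebraMap ℚ S E.a₄ := rfl
  have f6 : (E⁄S).a₆ = algebraMap ℚ S E.a₆ := rfl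
  rw [e1, e2, e3, e4, e6, f1, f2, f3, f4, f6]
  simp only [Matrix.cons_val]
  refine Iff.trans (Eq.congr_left ?_) hu.mul_right_eq_zero
  generalize algebraMap ℚ S (1 / 2) = h at *
  generalize algebraMap ℚ S D = d at *
  obtain rfl : d = δ ^ 2 := hδ.symm
  generalize algebraMap ℚ S E.a₁ = a₁
  generalize algebraMap ℚ S E.a₃ = a₃
  linear_combination (δ ^ 4 * v 2 * (h * (a₁ * δ ^ 2 * v 0 + a₃ * δ ^ 4 * v 2) ^ 2 -
    δ * v 1 * (a₁ * δ ^ 2 * v 0 + a₃ * δ ^ 4 * v 2)) -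
    δ ^ 10 * h * a₁ * a₃ * v 0 * v 2 ^ 2) * h2

namespace CurvePoint

/-- For a square root `δ` of `D`, the isomorphism of the quadratic twist of `E` by `D` with `E`. -/
def untwist (hD : D ≠ 0) {δ : S} (hδ : δ ^ 2 = algebraMap ℚ S D)
    (p : CurvePoint (quadraticTwist E D) S) : CurvePoint E S where
  toProjPoint := p.toProjPoint.mapLinear (untwistLinear E hD hδ)
  equation := by
    rintro _ ⟨v, hv, rfl⟩
    exact (equation_untwistLinear_iff E hD hδ v).mpr (p.equation v hv)

lemma mem_untwist (hD : D ≠ 0) {δ : S} (hδ : δ ^ 2 = algebraMap ℚ S D)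
    {p : CurvePoint (quadraticTwist E D) S} {v : Fin 3 → S} (hv : v ∈ p.line) :
    untwistLinear E hD hδ v ∈ (p.untwist E hD hδ).line :=
  ⟨v, hv, rfl⟩

lemma untwist_bijective (hD : D ≠ 0) {δ : S} (hδ : δ ^ 2 = algebraMap ℚ S D) :
    Function.Bijective (untwist E hD hδ) := by
  constructor
  · intro p p' h
    exact CurvePoint.ext (Submodule.map_injective_of_injective
      (untwistLinear E hD hδ).injective (congrArg (fun e => e.line) h))
  · intro q
    have hmap : (q.toProjPoint.mapLinear (untwistLinear E hD hδ).symm).mapLinear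
        (untwistLinear E hD hδ) = q.toProjPoint := by
      refine ProjPoint.eq_of_le ?_
      rintro _ ⟨_, ⟨v, hv, rfl⟩, rfl⟩
      simpa using hv
    refine ⟨⟨q.toProjPoint.mapLinear (untwistLinear E hD hδ).symm, ?_⟩, toProjPoint_injective hmap⟩
    rintro _ ⟨v, hv, rfl⟩
    rw [← equation_untwistLinear_iff E hD hδ]
    simpa using q.equation v hv

lemma map_untwist (hD : D ≠ 0) {δ : S} (hδ : δ ^ 2 = algebraMap ℚ S D) {δ' : S'}
    (hδ' : δ' ^ 2 = algebraMap ℚ S' D) (g : S →ₐ[ℚ] S') (hg : g δ = δ')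
    (p : CurvePoint (quadraticTwist E D) S) :
    (p.untwist E hD hδ).map g = (p.map g).untwist E hD hδ' := by
  subst hg
  refine eq_of_le (Submodule.span_le.mpr ?_)
  rintro _ ⟨_, ⟨v, hv, rfl⟩, rfl⟩
  refine ⟨g ∘ v, ProjPoint.comp_mem_map _ _ hv, ?_⟩
  ext i
  fin_cases i <;> simp [untwistLinear_apply]

lemma neg_mem_neg {p : CurvePoint E S} {v : Fin 3 → S} (hv : v ∈ p.line) :
    (E⁄S).toProjective.neg v ∈ p.neg.line :=
  Submodule.subset_span ⟨v, hv, rfl⟩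

/-- Untwisting makes 2y + a₁x + a₃ proportional to δY, and [-1] changes its sign. This is the source
of oddness in `toFibre` and of conjugation invariance in `toFibre_surjective`. -/
lemma neg_untwist (hD : D ≠ 0) {δ δ' : S} (hδ : δ ^ 2 = algebraMap ℚ S D)
    (hδ' : δ' ^ 2 = algebraMap ℚ S D) (h : δ' = -δ) (p : CurvePoint (quadraticTwist E D) S) :
    (p.untwist E hD hδ).neg = p.untwist E hD hδ' := by
  subst h
  refine eq_of_le (Submodule.span_le.mpr ?_)
  rintro _ ⟨_, ⟨v, hv, rfl⟩, rfl⟩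
  refine ⟨v, hv, ?_⟩
  have h2 : 2 * algebraMap ℚ S (1 / 2) = 1 := two_mul_half
  have f1 : (E⁄S).a₁ = algebraMap ℚ S E.a₁ := rfl
  have f3 : (E⁄S).a₃ = algebraMap ℚ S E.a₃ := rfl
  ext i
  simp only [LinearEquiv.coe_coe, untwistLinear_apply, WeierstrassCurve.Projective.neg,
    WeierstrassCurve.Projective.negY, Matrix.cons_val, f1, f3]
  fin_cases i
  · rfl
  · simp only [Fin.mk_one, Matrix.cons_val]
    linear_combination -(algebraMap ℚ S E.a₁ * algebraMap ℚ S D * v 0 +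
      algebraMap ℚ S E.a₃ * algebraMap ℚ S D ^ 2 * v 2) * h2
  · rfl

lemma origin_mem : ![0, 1, 0] ∈ (origin E S).line :=
  Submodule.subset_span rfl

lemma isUnit_of_sq (hD : D ≠ 0) {δ : S} (hδ : δ ^ 2 = algebraMap ℚ S D) : IsUnit δ :=
  (isUnit_pow_iff two_ne_zero).mp (hδ ▸ (IsUnit.mk0 D hD).map (algebraMap ℚ S))

lemma map_origin (g : S →ₐ[ℚ] S') : (origin E S).map g = origin E S' := by
  have h : (g : S →+* S') ∘ ![0, 1, 0] ∈ ((origin E S).map g).line :=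
    ProjPoint.comp_mem_map _ _ (origin_mem E)
  refine toProjPoint_injective (ProjPoint.eq_of_mem (i := 1) isUnit_one ?_ (origin_mem E))
  convert! h
  ext i; fin_cases i <;> simp

lemma untwist_origin (hD : D ≠ 0) {δ : S} (hδ : δ ^ 2 = algebraMap ℚ S D) :
    (origin (quadraticTwist E D) S).untwist E hD hδ = origin E S := by
  have h := mem_untwist E hD hδ (origin_mem (S := S) (quadraticTwist E D))
  refine toProjPoint_injective (ProjPoint.eq_of_mem (u := δ • ![0, 1, 0]) (i := 1) ?_ ?_
    ((origin E S).line.smul_mem _ (origin_mem E)))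
  · simpa using isUnit_of_sq hD hδ
  · have heq : δ • ![0, 1, 0] = untwistLinear E hD hδ ![0, 1, 0] := by
      ext i; fin_cases i <;> simp [untwistLinear_apply]
    exact heq ▸ h

end CurvePoint

end Untwist

/-! ### Points of E over x as square roots of the discriminant -/

section Root

/-- The point `(x : 1)` of `L`. -/
def affinePoint (x : ℚ) : ProjPoint 2 ℚ :=
  .ofSpan {![x, 1]} (by rintro _ rfl _ rfl i j; ring)
    ((Ideal.eq_top_iff_one _).mpr (Ideal.subset_span ⟨_, rfl, 1, rfl⟩))

variable (E : WeierstrassCurve ℚ) (x : ℚ) {S S' : Type} [CommRing S] [Algebra ℚ S] [CommRing S']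
  [Algebra ℚ S']

lemma mem_const_affinePoint : ![algebraMap ℚ S x, 1] ∈ (const (affinePoint x) S).line := by
  have h : algebraMap ℚ S ∘ ![x, 1] ∈ (const (affinePoint x) S).line :=
    ProjPoint.comp_mem_map _ _ (Submodule.subset_span rfl)
  have heq : algebraMap ℚ S ∘ ![x, 1] = ![algebraMap ℚ S x, 1] := by
    ext i; fin_cases i <;> simp
  exact heq ▸ h

/-- The discriminant of the equation `π = x`. -/
def fibreDisc : ℚ := 4 * x ^ 3 + E.b₂ * x ^ 2 + 2 * E.b₄ * x + E.b₆

/-- The vector of coordinates of the point of `E` over `x` where `2 y + a₁ x + a₃` is `δ`. -/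
def fibreVec (δ : S) : Fin 3 → S :=
  ![algebraMap ℚ S x, algebraMap ℚ S (1 / 2) * (δ - algebraMap ℚ S (E.a₁ * x + E.a₃)), 1]

/-- Completing the square: four times the Weierstrass equation at this vector is the right-hand
side, and 4 is a unit. -/
lemma equation_fibreVec_iff (δ : S) : (E⁄S).toProjective.Equation (fibreVec E x δ) ↔
    δ ^ 2 = algebraMap ℚ S (fibreDisc E x) := by
  have h2 : 2 * algebraMap ℚ S (1 / 2) = 1 := two_mul_half
  have hu : IsUnit (4 : S) := by
    have := (IsUnit.mk0 (4 : ℚ) four_ne_zero).map (algebraMap ℚ S)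
    rwa [map_ofNat] at this
  have f1 : (E⁄S).a₁ = algebraMap ℚ S E.a₁ := rfl
  have f2 : (E⁄S).a₂ = algebraMap ℚ S E.a₂ := rfl
  have f3 : (E⁄S).a₃ = algebraMap ℚ S E.a₃ := rfl
  have f4 : (E⁄S).a₄ = algebraMap ℚ S E.a₄ := rfl
  have f6 : (E⁄S).a₆ = algebraMap ℚ S E.a₆ := rfl
  rw [WeierstrassCurve.Projective.equation_iff, f1, f2, f3, f4, f6, ← sub_eq_zero,
    ← hu.mul_right_eq_zero, ← sub_eq_zero (a := δ ^ 2)]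
  simp only [fibreVec, fibreDisc, Matrix.cons_val, WeierstrassCurve.b₂, WeierstrassCurve.b₄,
    WeierstrassCurve.b₆, map_add, map_mul, map_pow, map_ofNat]
  refine Eq.congr_left ?_
  generalize algebraMap ℚ S (1 / 2) = h at *
  generalize algebraMap ℚ S E.a₁ = a₁
  generalize algebraMap ℚ S E.a₃ = a₃
  generalize algebraMap ℚ S x = x
  linear_combination ((2 * h + 1) * (δ - (a₁ * x + a₃)) ^ 2 +
    2 * (a₁ * x + a₃) * (δ - (a₁ * x + a₃))) * h2

lemma fibreVec_injective : Function.Injective (fibreVec (S := S) E x) := by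
  intro δ δ' h
  have h1 : algebraMap ℚ S (1 / 2) * (δ - algebraMap ℚ S (E.a₁ * x + E.a₃)) =
    algebraMap ℚ S (1 / 2) * (δ' - algebraMap ℚ S (E.a₁ * x + E.a₃)) := congrFun h 1
  linear_combination 2 * h1 + (δ' - δ) * two_mul_half (S := S)

namespace CurvePoint

variable {E x}

lemma eq_of_fibreVec_mem {e e' : CurvePoint E S} {δ : S} (h : fibreVec E x δ ∈ e.line)
    (h' : fibreVec E x δ ∈ e'.line) : e = e' :=
  toProjPoint_injective (ProjPoint.eq_of_mem (i := 2) isUnit_one h h')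

lemma fibreVec_unique {e : CurvePoint E S} {δ δ' : S} (h : fibreVec E x δ ∈ e.line)
    (h' : fibreVec E x δ' ∈ e.line) : δ = δ' := by
  refine fibreVec_injective E x ?_
  ext i
  have := e.minors _ h _ h' i 2
  simpa [fibreVec] using this

lemma fibreVec_mem_map {e : CurvePoint E S} {δ : S} (h : fibreVec E x δ ∈ e.line)
    (g : S →ₐ[ℚ] S') : fibreVec E x (g δ) ∈ (e.map g).line := by
  have h1 : (g : S →+* S') ∘ fibreVec E x δ ∈ (e.map g).line := ProjPoint.comp_mem_map _ _ h
  have heq : (g : S →+* S') ∘ fibreVec E x δ = fibreVec E x (g δ) := by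
    ext i; fin_cases i <;> simp [fibreVec]
  exact heq ▸ h1

lemma fibreVec_mem_neg {e : CurvePoint E S} {δ : S} (h : fibreVec E x δ ∈ e.line) :
    fibreVec E x (-δ) ∈ e.neg.line := by
  have heq : (E⁄S).toProjective.neg (fibreVec E x δ) = fibreVec E x (-δ) := by
    have f1 : (E⁄S).a₁ = algebraMap ℚ S E.a₁ := rfl
    have f3 : (E⁄S).a₃ = algebraMap ℚ S E.a₃ := rfl
    ext i
    simp only [fibreVec, WeierstrassCurve.Projective.neg, WeierstrassCurve.Projective.negY,
      Matrix.cons_val, f1, f3, map_add, map_mul]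
    fin_cases i
    · rfl
    · simp only [Fin.mk_one, Matrix.cons_val]
      linear_combination (algebraMap ℚ S E.a₁ * algebraMap ℚ S x + algebraMap ℚ S E.a₃) *
        two_mul_half (S := S)
    · rfl
  exact heq ▸ neg_mem_neg E h

/-- A point of `E` over `x` is given by a square root of the discriminant. -/
lemma exists_fibreVec_mem {e : CurvePoint E S} (h : e.toLine = const (affinePoint x) S) :
    ∃ δ, fibreVec E x δ ∈ e.line := by
  have hx := mem_const_affinePoint (S := S) x
  rw [← h] at hx
  have h0 : ∀ v ∈ e.line, v 0 = algebraMap ℚ S x * v 2 := fun v hv => by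
    have := e.toLine.minors ![v 0, v 2] (Submodule.subset_span ⟨v, hv, .inl rfl⟩) _ hx 0 1
    simp only [Matrix.cons_val] at this
    linear_combination this
  have h1 := fun v hv => e.toLine.minors _ (Submodule.subset_span ⟨v, hv, .inr rfl⟩) _ hx 0 1
  simp only [Matrix.cons_val] at h1
  -- Over a general ring a vector with Z = 1 must be found. Over x one has X = xZ, and the second
  -- chart of π makes Y² a multiple of Z, so the values of Z generate an ideal with radical (1).
  let I : Ideal S := e.line.map (LinearMap.proj 2)
  have hI : I = ⊤ := by
    rw [← Ideal.radical_eq_top, ← top_le_iff, ← e.unimodular, Ideal.span_le]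
    rintro _ ⟨v, hv, i, rfl⟩
    have h2 : v 2 ∈ I := ⟨v, hv, rfl⟩
    fin_cases i
    · refine Ideal.le_radical ?_
      simpa only [Fin.zero_eta, h0 v hv] using I.mul_mem_left _ h2
    · refine ⟨2, ?_⟩
      have h3 := h1 v hv
      have h4 : v 1 ^ 2 = v 2 * (v 0 * algebraMap ℚ S x ^ 2 - (E⁄S).a₁ * algebraMap ℚ S x * v 1
          - (E⁄S).a₃ * v 1 + (E⁄S).a₂ * algebraMap ℚ S x * v 0 + (E⁄S).a₄ * v 0
          + (E⁄S).a₆ * v 2) := by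
        linear_combination h3 + (v 0 * algebraMap ℚ S x - (E⁄S).a₁ * v 1 + (E⁄S).a₂ * v 0) * h0 v hv
      simp only [Fin.mk_one, h4]
      exact I.mul_mem_right _ h2
    · exact Ideal.le_radical h2
  obtain ⟨v, hv, hv2⟩ : (1 : S) ∈ I := hI ▸ Submodule.mem_top
  replace hv2 : v 2 = 1 := hv2
  refine ⟨2 * v 1 + algebraMap ℚ S (E.a₁ * x + E.a₃), ?_⟩
  have heq : fibreVec E x (2 * v 1 + algebraMap ℚ S (E.a₁ * x + E.a₃)) = v := by
    ext i
    fin_cases i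
    · simp [fibreVec, h0 v hv, hv2]
    · simp only [fibreVec, Fin.mk_one, Matrix.cons_val]
      linear_combination v 1 * two_mul_half (S := S)
    · simp [fibreVec, hv2]
  rw [heq]
  exact hv

variable (E x) in
open scoped Classical in
/-- The square root of the discriminant which is given by a point of `E` over `x`. -/
noncomputable def root (e : CurvePoint E S) : S :=
  -- The default 0 never occurs for points over x, and by `fibreVec_unique` the choice is forced.
  if h : ∃ δ, fibreVec E x δ ∈ e.line then h.choose else 0

lemma root_eq {e : CurvePoint E S} {δ : S} (h : fibreVec E x δ ∈ e.line) : e.root E x = δ := by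
  have hex : ∃ δ, fibreVec E x δ ∈ e.line := ⟨δ, h⟩
  rw [root, dif_pos hex]
  exact fibreVec_unique hex.choose_spec h

lemma fibreVec_root_mem {e : CurvePoint E S} (h : e.toLine = const (affinePoint x) S) :
    fibreVec E x (e.root E x) ∈ e.line := by
  obtain ⟨δ, hδ⟩ := exists_fibreVec_mem h
  rwa [root_eq hδ]

lemma root_sq {e : CurvePoint E S} (h : e.toLine = const (affinePoint x) S) :
    e.root E x ^ 2 = algebraMap ℚ S (fibreDisc E x) :=
  (equation_fibreVec_iff E x _).mp (e.equation _ (fibreVec_root_mem h))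

variable (E x) in
/-- The point of `E` over `x` which is given by a square root of the discriminant. -/
def ofRoot {δ : S} (hδ : δ ^ 2 = algebraMap ℚ S (fibreDisc E x)) : CurvePoint E S :=
  ofAffine ((WeierstrassCurve.Projective.equation_some _ _).mp
    ((equation_fibreVec_iff E x δ).mpr hδ))

lemma fibreVec_mem_ofRoot {δ : S} (hδ : δ ^ 2 = algebraMap ℚ S (fibreDisc E x)) :
    fibreVec E x δ ∈ (ofRoot E x hδ).line :=
  Submodule.subset_span rfl

lemma toLine_ofRoot {δ : S} (hδ : δ ^ 2 = algebraMap ℚ S (fibreDisc E x)) :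
    (ofRoot E x hδ).toLine = const (affinePoint x) S :=
  ProjPoint.eq_of_mem (i := 1) isUnit_one
    (Submodule.subset_span ⟨_, fibreVec_mem_ofRoot hδ, .inl rfl⟩) (mem_const_affinePoint x)

end CurvePoint

end Root

/-! ### The isomorphism of the twist by the discriminant with the fibre -/

open CurvePoint

lemma Twist.app_congr {E : WeierstrassCurve ℚ} {R S : Type} [CommRing R] [Algebra ℚ R] [CommRing S]
    [Algebra ℚ S] {t : ProjPoint 2 R} (φ : Twist E R t) {f f' : R →ₐ[ℚ] S} {e e' : CurvePoint E S}
    (hf : f = f') (he : e = e') (h : e.toLine = t.map (f : R →+* S))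
    (h' : e'.toLine = t.map (f' : R →+* S)) : φ.app S f e h = φ.app S f' e' h' := by
  subst hf he
  rfl

variable (E : WeierstrassCurve ℚ) {x : ℚ}

/-- The point of the fibre of the self-twist at `(x : 1)` which is given by a point of the quadratic
twist by the discriminant. -/
noncomputable def toFibre (hx : fibreDisc E x ≠ 0) (R : Type) [CommRing R] [Algebra ℚ R]
    (p : CurvePoint (quadraticTwist E (fibreDisc E x)) R) : Fibre E (affinePoint x) R where
  -- The root attached to e commutes with base change and changes sign under [-1]; this gives the
  -- other two fields.
  app S _ _ f e h := (p.map f).untwist E hx (root_sq (h.trans (map_const _ f)))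
  natural S S' _ _ _ _ f g e h := by
    have he := h.trans (map_const _ f)
    rw [map_untwist E hx (root_sq he) _ g (root_eq (fibreVec_mem_map (fibreVec_root_mem he) g)).symm,
      CurvePoint.map_map]
  odd S _ _ f e h :=
    (neg_untwist E hx _ _ (root_eq (fibreVec_mem_neg (fibreVec_root_mem (h.trans (map_const _ f)))))
      _).symm

section Universal

variable (x) (R : Type) [CommRing R] [Algebra ℚ R]

/-- The coordinate ring of the double cover which is given by the fibre of `π` at `(x : 1)`. -/
abbrev FibreRing : Type := QuadraticAlgebra R (algebraMap ℚ R (fibreDisc E x)) 0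

lemma omega_sq : (QuadraticAlgebra.omega : FibreRing E x R) ^ 2 =
    algebraMap ℚ (FibreRing E x R) (fibreDisc E x) := by
  rw [pow_two, QuadraticAlgebra.omega_mul_omega_eq_algebraMap, map_zero, zero_mul, add_zero,
    ← IsScalarTower.algebraMap_apply]

/-- The universal property of the coordinate ring of the fibre of `π`. -/
lemma exists_fibreRing_algHom {S : Type} [CommRing S] [Algebra ℚ S] (f : R →ₐ[ℚ] S) {δ : S}
    (hδ : δ ^ 2 = algebraMap ℚ S (fibreDisc E x)) :
    ∃ k : FibreRing E x R →ₐ[ℚ] S, k.comp (quadraticIncl R _) = f ∧ k QuadraticAlgebra.omega = δ := by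
  let : Algebra R S := f.toRingHom.toAlgebra
  have : IsScalarTower ℚ R S := .of_algebraMap_eq' f.comp_algebraMap.symm
  have hlift : δ * δ = algebraMap ℚ R (fibreDisc E x) • 1 + (0 : R) • δ := by
    rw [← pow_two, hδ, zero_smul, add_zero, ← Algebra.algebraMap_eq_smul_one,
      ← IsScalarTower.algebraMap_apply]
  let k : FibreRing E x R →ₐ[R] S := QuadraticAlgebra.lift ⟨δ, hlift⟩
  refine ⟨k.restrictScalars ℚ, ?_, ?_⟩
  · exact AlgHom.ext fun r => k.commutes r
  · change k _ = δ
    simp [k, QuadraticAlgebra.lift]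

/-- The universal point of `E` over `(x : 1)`. -/
abbrev universalPoint : CurvePoint E (FibreRing E x R) := ofRoot E x (omega_sq E x R)

variable {x R}

/-- The value at the universal point already determines p, as untwisting is bijective and base
change to R[√D] is injective. -/
lemma toFibre_injective (hx : fibreDisc E x ≠ 0) : Function.Injective (toFibre E hx R) := by
  intro p p' h
  have hl : (universalPoint E x R).toLine = (const (affinePoint x) R).map
      (quadraticIncl R (algebraMap ℚ R (fibreDisc E x)) : R →+* FibreRing E x R) :=
    (toLine_ofRoot _).trans (map_const _ _).symm
  have h1 : (toFibre E hx R p).app _ (quadraticIncl R _) _ hl =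
    (toFibre E hx R p').app _ (quadraticIncl R _) _ hl := by rw [h]
  exact map_quadratic_injective _ ((untwist_bijective E hx _).1 h1)

lemma toFibre_surjective (hx : fibreDisc E x ≠ 0) : Function.Surjective (toFibre E hx R) := by
  intro φ
  let d : R := algebraMap ℚ R (fibreDisc E x)
  have hd : IsUnit d := (IsUnit.mk0 _ hx).map (algebraMap ℚ R)
  let ι : R →ₐ[ℚ] FibreRing E x R := quadraticIncl R d
  let σ : FibreRing E x R →ₐ[ℚ] FibreRing E x R := (conj d).restrictScalars ℚ
  let u := universalPoint E x R
  have hu : fibreVec E x QuadraticAlgebra.omega ∈ u.line := fibreVec_mem_ofRoot _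
  have hl : u.toLine = (const (affinePoint x) R).map (ι : R →+* FibreRing E x R) :=
    (toLine_ofRoot _).trans (map_const _ _).symm
  obtain ⟨p', hp'⟩ := (untwist_bijective E hx (omega_sq E x R)).2 (φ.app _ ι u hl)
  have hσω : σ QuadraticAlgebra.omega = -QuadraticAlgebra.omega := by
    change conj d _ = _
    ext <;> simp
  have hω' : (-QuadraticAlgebra.omega : FibreRing E x R) ^ 2 =
      algebraMap ℚ (FibreRing E x R) (fibreDisc E x) := by rw [neg_sq, omega_sq]
  have hσu : u.map σ = u.neg :=
    eq_of_fibreVec_mem (hσω ▸ fibreVec_mem_map hu σ) (fibreVec_mem_neg hu)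
  have hσι : σ.comp ι = ι := by
    exact AlgHom.ext fun r => (conj d).commutes r
  -- Conjugation sends u to -u, so by naturality and oddness it negates φ(u). It also replaces the
  -- untwisting root ω by -ω, which accounts for exactly that sign.
  have hinv : p'.map σ = p' := by
    refine (untwist_bijective E hx hω').1 ?_
    rw [← map_untwist E hx (omega_sq E x R) hω' σ hσω, hp', ← φ.natural _ _ ι σ u hl,
      φ.app_congr hσι hσu _ ((toLine_neg u).trans hl), φ.odd _ _ _ hl, ← hp']
    exact neg_untwist E hx _ _ rfl _
  obtain ⟨p, hp⟩ := exists_map_quadratic hd p' hinv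
  refine ⟨p, ?_⟩
  ext S _ _ f e h
  have he := h.trans (map_const _ f)
  -- Every point e over x is the image of u under some k, so naturality reduces equality of the two
  -- morphisms to their values at u.
  obtain ⟨k, hkf, hk⟩ := exists_fibreRing_algHom E x R f (root_sq he)
  have hue : u.map k = e :=
    eq_of_fibreVec_mem (hk ▸ fibreVec_mem_map hu k) (fibreVec_root_mem he)
  rw [← φ.app_congr hkf hue ((toLine_map_eq hl k)) h, φ.natural _ _ ι k u hl, ← hp',
    map_untwist E hx (omega_sq E x R) (root_sq he) k hk, ← hp, CurvePoint.map_map, hkf]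
  rfl

end Universal

/-! ### Compatibility with the group law on field points -/

section FieldPoints

open WeierstrassCurve

/-- The curve `W` is obtained from `V` by completing the square and scaling by `δ`. -/
structure IsShortModel {F : Type} [Field F] (W V : WeierstrassCurve F) (δ : F) : Prop where
  ne_zero : δ ≠ 0
  a₁ : W.a₁ = 0
  a₂ : W.a₂ = δ ^ 2 * (V.a₁ ^ 2 / 4 + V.a₂)
  a₃ : W.a₃ = 0
  a₄ : W.a₄ = δ ^ 4 * (V.a₁ * V.a₃ / 2 + V.a₄)
  a₆ : W.a₆ = δ ^ 6 * (V.a₃ ^ 2 / 4 + V.a₆)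

namespace IsShortModel

variable {F : Type} [Field F] [CharZero F] {W V : WeierstrassCurve F} {δ : F}

lemma equation (h : IsShortModel W V δ) {X Y : F} (hXY : W.toAffine.Equation X Y) :
    V.toAffine.Equation (X / δ ^ 2) (Y / δ ^ 3 - (V.a₁ * (X / δ ^ 2) + V.a₃) / 2) := by
  have h0 := h.ne_zero
  rw [Affine.equation_iff] at hXY ⊢
  rw [h.a₁, h.a₂, h.a₃, h.a₄, h.a₆] at hXY
  field_simp
  linear_combination 4 * hXY

open Classical in
-- The coordinate change scales slopes by δ²/δ³, and the shear by -(a₁x + a₃)/2 subtracts a₁/2.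
lemma slope (h : IsShortModel W V δ) {X₁ X₂ Y₁ Y₂ : F} (h₁ : W.toAffine.Equation X₁ Y₁)
    (h₂ : W.toAffine.Equation X₂ Y₂) (hxy : ¬(X₁ = X₂ ∧ Y₁ = W.toAffine.negY X₂ Y₂)) :
    V.toAffine.slope (X₁ / δ ^ 2) (X₂ / δ ^ 2) (Y₁ / δ ^ 3 - (V.a₁ * (X₁ / δ ^ 2) + V.a₃) / 2)
      (Y₂ / δ ^ 3 - (V.a₁ * (X₂ / δ ^ 2) + V.a₃) / 2) =
      W.toAffine.slope X₁ X₂ Y₁ Y₂ / δ - V.a₁ / 2 := by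
  have h0 := h.ne_zero
  by_cases hX : X₁ = X₂
  · have hY : Y₁ ≠ W.toAffine.negY X₂ Y₂ := fun hY => hxy ⟨hX, hY⟩
    have hYe := Affine.Y_eq_of_Y_ne h₁ h₂ hX hY
    subst hX hYe
    have hY0 : Y₁ ≠ 0 := by
      rintro rfl
      exact hY (by simp [Affine.negY, h.a₁, h.a₃])
    have hy : Y₁ / δ ^ 3 - (V.a₁ * (X₁ / δ ^ 2) + V.a₃) / 2 -
        V.toAffine.negY (X₁ / δ ^ 2) (Y₁ / δ ^ 3 - (V.a₁ * (X₁ / δ ^ 2) + V.a₃) / 2) =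
        2 * Y₁ / δ ^ 3 := by
      simp only [Affine.negY]; ring
    have hy' : Y₁ - W.toAffine.negY X₁ Y₁ = 2 * Y₁ := by
      simp only [Affine.negY, h.a₁, h.a₃]; ring
    rw [Affine.slope_of_Y_ne rfl hY, Affine.slope_of_Y_ne rfl, hy, hy', h.a₁, h.a₂, h.a₄]
    · field_simp
      ring
    · rw [← sub_ne_zero, hy]
      exact div_ne_zero (mul_ne_zero two_ne_zero hY0) (pow_ne_zero 3 h0)
  · have hX' : X₁ / δ ^ 2 ≠ X₂ / δ ^ 2 := fun h => hX ((div_left_inj' (pow_ne_zero 2 h0)).mp h)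
    have hX'' : X₁ - X₂ ≠ 0 := sub_ne_zero.mpr hX
    have hsub : X₁ / δ ^ 2 - X₂ / δ ^ 2 = (X₁ - X₂) / δ ^ 2 := by ring
    rw [Affine.slope_of_X_ne hX, Affine.slope_of_X_ne hX', hsub]
    field_simp
    ring

/-- The map on points which corresponds to completing the square and scaling. -/
def toPoint [V.IsElliptic] (h : IsShortModel W V δ) : W.toAffine.Point → V.toAffine.Point
  | .zero => .zero
  | .some _ _ hXY => .some _ _ (Affine.equation_iff_nonsingular.mp (h.equation hXY.1))

open Classical in
lemma toPoint_add [V.IsElliptic] (h : IsShortModel W V δ) (P Q : W.toAffine.Point) :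
    h.toPoint (P + Q) = h.toPoint P + h.toPoint Q := by
  have h0 := h.ne_zero
  rcases P with _ | ⟨X₁, Y₁, h₁⟩
  · change h.toPoint (0 + Q) = 0 + h.toPoint Q
    rw [zero_add, zero_add]
  rcases Q with _ | ⟨X₂, Y₂, h₂⟩
  · change h.toPoint (_ + 0) = h.toPoint _ + 0
    rw [add_zero, add_zero]
  by_cases hxy : X₁ = X₂ ∧ Y₁ = W.toAffine.negY X₂ Y₂
  · rw [Affine.Point.add_of_Y_eq hxy.1 hxy.2]
    simp only [toPoint]
    rw [Affine.Point.add_of_Y_eq (by rw [hxy.1])]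
    · rfl
    · rw [hxy.1, hxy.2]
      simp only [Affine.negY, h.a₁, h.a₃]
      ring
  · rw [Affine.Point.add_some hxy]
    simp only [toPoint]
    rw [Affine.Point.add_some]
    · rw [Affine.Point.some.injEq, h.slope h₁.1 h₂.1 hxy]
      simp only [Affine.addX, Affine.addY, Affine.negAddY, Affine.negY, h.a₁, h.a₂, h.a₃]
      constructor <;> field_simp <;> ring
    · rintro ⟨hX, hY⟩
      have hX' : X₁ = X₂ := (div_left_inj' (pow_ne_zero 2 h0)).mp hX
      refine hxy ⟨hX', ?_⟩
      subst hX'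
      simp only [Affine.negY, h.a₁, h.a₃] at hY ⊢
      field_simp at hY
      linear_combination hY / 2

end IsShortModel

variable (E : WeierstrassCurve ℚ) {D : ℚ} {F : Type} [Field F] [Algebra ℚ F]

lemma isShortModel_quadraticTwist (hD : D ≠ 0) {δ : F} (hδ : δ ^ 2 = algebraMap ℚ F D) :
    IsShortModel ((quadraticTwist E D)⁄F) (E⁄F) δ where
  ne_zero := (CurvePoint.isUnit_of_sq hD hδ).ne_zero
  a₁ := map_zero _
  a₂ := by
    change algebraMap ℚ F (D * E.b₂ / 4) = δ ^ 2 * (algebraMap ℚ F E.a₁ ^ 2 / 4 + algebraMap ℚ F E.a₂)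
    rw [hδ]
    simp only [WeierstrassCurve.b₂, map_div₀, map_mul, map_add, map_pow, map_ofNat]
    have := algebraRat.charZero F
    field_simp
  a₃ := map_zero _
  a₄ := by
    change algebraMap ℚ F (D ^ 2 * E.b₄ / 2) =
      δ ^ 4 * (algebraMap ℚ F E.a₁ * algebraMap ℚ F E.a₃ / 2 + algebraMap ℚ F E.a₄)
    rw [show δ ^ 4 = (δ ^ 2) ^ 2 by ring, hδ]
    simp only [WeierstrassCurve.b₄, map_div₀, map_mul, map_add, map_pow, map_ofNat]
    have := algebraRat.charZero F
    field_simp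
    ring
  a₆ := by
    change algebraMap ℚ F (D ^ 3 * E.b₆ / 4) =
      δ ^ 6 * (algebraMap ℚ F E.a₃ ^ 2 / 4 + algebraMap ℚ F E.a₆)
    rw [show δ ^ 6 = (δ ^ 2) ^ 3 by ring, hδ]
    simp only [WeierstrassCurve.b₆, map_div₀, map_mul, map_add, map_pow, map_ofNat]
    have := algebraRat.charZero F
    field_simp

instance [E.IsElliptic] : (E⁄F).IsElliptic :=
  inferInstanceAs (E.map (algebraMap ℚ F)).IsElliptic

namespace CurvePoint

variable {E}

lemma mem_ofAffine {R : Type} [CommRing R] [Algebra ℚ R] {x y : R}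
    (h : (E⁄R).toAffine.Equation x y) : ![x, y, 1] ∈ (ofAffine h).line :=
  Submodule.subset_span rfl

lemma ofPoint_injective : Function.Injective (ofPoint : (E⁄F).toAffine.Point → CurvePoint E F) := by
  rintro (_ | ⟨x, y, h⟩) (_ | ⟨x', y', h'⟩) heq
  · rfl
  · have h1 : ![x', y', 1] ∈ (origin E F).line := by
      change origin E F = ofAffine h'.1 at heq
      exact heq ▸ mem_ofAffine h'.1
    have := (origin E F).minors _ h1 _ (origin_mem E) 2 1
    simp at this
  · have h1 : ![x, y, 1] ∈ (origin E F).line := by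
      change ofAffine h.1 = origin E F at heq
      exact heq ▸ mem_ofAffine h.1
    have := (origin E F).minors _ h1 _ (origin_mem E) 2 1
    simp at this
  · have h1 : ![x, y, 1] ∈ (ofAffine h'.1).line := by
      change ofAffine h.1 = ofAffine h'.1 at heq
      exact heq ▸ mem_ofAffine h.1
    have h2 := (ofAffine h'.1).minors _ h1 _ (mem_ofAffine h'.1) 0 2
    have h3 := (ofAffine h'.1).minors _ h1 _ (mem_ofAffine h'.1) 1 2
    simp only [Matrix.cons_val, mul_one, one_mul] at h2 h3
    subst h2 h3
    rfl

lemma map_ofAffine {R S : Type} [CommRing R] [Algebra ℚ R] [CommRing S] [Algebra ℚ S] {x y : R}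
    (f : R →ₐ[ℚ] S) (h : (E⁄R).toAffine.Equation x y) :
    ![f x, f y, 1] ∈ ((ofAffine h).map f).line := by
  have h1 : (f : R →+* S) ∘ ![x, y, 1] ∈ ((ofAffine h).map f).line :=
    ProjPoint.comp_mem_map _ _ (mem_ofAffine h)
  have heq : (f : R →+* S) ∘ ![x, y, 1] = ![f x, f y, 1] := by
    ext i; fin_cases i <;> simp
  exact heq ▸ h1

open Classical in
lemma map_ofPoint {K : Type} [Field K] [Algebra ℚ K] (f : K →ₐ[ℚ] F)
    (P : (E⁄K).toAffine.Point) : (ofPoint P).map f = ofPoint (Affine.Point.map f P) := by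
  rcases P with _ | ⟨x, y, h⟩
  · exact map_origin E f
  · refine toProjPoint_injective (ProjPoint.eq_of_mem (i := 2) isUnit_one (map_ofAffine f h.1) ?_)
    exact Submodule.subset_span rfl

lemma untwistLinear_affine (hD : D ≠ 0) {δ : F} (hδ : δ ^ 2 = algebraMap ℚ F D) (X Y : F) :
    untwistLinear E hD hδ ![X, Y, 1] =
      δ ^ 4 • ![X / δ ^ 2, Y / δ ^ 3 - ((E⁄F).a₁ * (X / δ ^ 2) + (E⁄F).a₃) / 2, 1] := by
  have h0 : δ ≠ 0 := (isUnit_of_sq hD hδ).ne_zero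
  have := algebraRat.charZero F
  have f1 : (E⁄F).a₁ = algebraMap ℚ F E.a₁ := rfl
  have f3 : (E⁄F).a₃ = algebraMap ℚ F E.a₃ := rfl
  rw [untwistLinear_apply, ← hδ, f1, f3]
  ext i
  fin_cases i
  · simp; field_simp
  · simp; field_simp; ring
  · simp; ring

/-- Links the untwisting of lines to the affine formula, so that `IsShortModel.toPoint_add` applies
to the fibre. -/
lemma untwist_ofPoint [E.IsElliptic] (hD : D ≠ 0) {δ : F} (hδ : δ ^ 2 = algebraMap ℚ F D)
    (h : IsShortModel ((quadraticTwist E D)⁄F) (E⁄F) δ)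
    (P : ((quadraticTwist E D)⁄F).toAffine.Point) :
    (ofPoint P).untwist E hD hδ =
      ofPoint (@IsShortModel.toPoint _ _ (algebraRat.charZero F) _ _ _ _ h P) := by
  rcases P with _ | ⟨X, Y, hXY⟩
  · exact untwist_origin E hD hδ
  · have hm := mem_untwist E hD hδ (mem_ofAffine hXY.1)
    rw [untwistLinear_affine] at hm
    refine toProjPoint_injective (ProjPoint.eq_of_mem (i := 2) isUnit_one
      (ProjPoint.mem_line_of_smul_mem _ ((isUnit_of_sq hD hδ).pow 4) hm) ?_)
    exact Submodule.subset_span rfl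

end CurvePoint

end FieldPoints

/-! ### The elliptic model and the canonical point -/

open WeierstrassCurve CurvePoint

/-- The quadratic twist of `E` by the discriminant of the fibre of `π` at `(x : 1)` is a model of
the fibre of the self-twist at `(x : 1)`. -/
noncomputable def ellipticModel (E : WeierstrassCurve ℚ) [E.IsElliptic] {x : ℚ}
    (hx : fibreDisc E x ≠ 0) : EllipticModel E (affinePoint x) where
  curve := quadraticTwist E (fibreDisc E x)
  isElliptic := quadraticTwist_isElliptic hx
  equiv R _ _ := .ofBijective (toFibre E hx R) ⟨toFibre_injective E hx, toFibre_surjective E hx⟩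
  natural R R' _ _ _ _ g p := by
    refine Twist.ext ?_
    funext S _ _ f e h
    change ((p.map g).map f).untwist E hx _ = (p.map (f.comp g)).untwist E hx _
    rw [CurvePoint.map_map]
  map_origin R S _ _ _ _ f e h := by
    change ((origin _ R).map f).untwist E hx _ = _
    rw [CurvePoint.map_origin, untwist_origin]
  map_add K F _ _ _ _ f e h P Q p q hP hQ := by
    classical
    have := algebraRat.charZero F
    have hδ := root_sq (h.trans (map_const _ f))
    have hs := isShortModel_quadraticTwist E hx hδ
    have key : ∀ P : ((quadraticTwist E (fibreDisc E x))⁄K).toAffine.Point,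
        ((ofPoint P).map f).untwist E hx hδ = ofPoint (hs.toPoint (Affine.Point.map f P)) := by
      intro P
      rw [map_ofPoint, untwist_ofPoint hx hδ hs]
    change ((ofPoint P).map f).untwist E hx hδ = _ at hP
    change ((ofPoint Q).map f).untwist E hx hδ = _ at hQ
    change ((ofPoint (P + Q)).map f).untwist E hx hδ = _
    rw [key] at hP hQ ⊢
    rw [← ofPoint_injective hP, ← ofPoint_injective hQ, map_add, hs.toPoint_add]

/-- The point of E over x with root δ has y = (δ - a₁x - a₃)/2, so on the twist X = δ²x = Dx and Y =
δ³ · δ/2 = D²/2, which are rational. -/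
lemma equation_fibreDisc (E : WeierstrassCurve ℚ) (x : ℚ) :
    (quadraticTwist E (fibreDisc E x)).toAffine.Equation (fibreDisc E x * x)
      (fibreDisc E x ^ 2 / 2) := by
  rw [quadraticTwist_equation_iff]
  simp only [fibreDisc]
  ring

/-- The point of the quadratic twist by the discriminant which corresponds to the canonical
section. -/
lemma toFibre_eq_canonicalSection (E : WeierstrassCurve ℚ) {x : ℚ} (hx : fibreDisc E x ≠ 0)
    (h : ((quadraticTwist E (fibreDisc E x))⁄ℚ).toAffine.Equation (fibreDisc E x * x)
      (fibreDisc E x ^ 2 / 2)) :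
    toFibre E hx ℚ (ofAffine h) = canonicalSection E ℚ (const (affinePoint x) ℚ) := by
  refine Twist.ext ?_
  funext S _ _ f e he
  have he' := he.trans (map_const _ f)
  have hδ := root_sq he'
  change ((ofAffine h).map f).untwist E hx hδ = e
  have hm := mem_untwist E hx hδ (map_ofAffine f h)
  refine eq_of_fibreVec_mem (ProjPoint.mem_line_of_smul_mem _
    (((IsUnit.mk0 _ hx).map (algebraMap ℚ S)).pow 2) ?_) (fibreVec_root_mem he')
  -- The factor D² = δ⁴ is the one by which `untwistLinear` clears denominators.
  have heq : algebraMap ℚ S (fibreDisc E x) ^ 2 • fibreVec E x (e.root E x) =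
      untwistLinear E hx hδ ![f (fibreDisc E x * x), f (fibreDisc E x ^ 2 / 2), 1] := by
    rw [untwistLinear_apply, ← Algebra.algebraMap_self_apply (fibreDisc E x * x),
      ← Algebra.algebraMap_self_apply (fibreDisc E x ^ 2 / 2), f.commutes, f.commutes,
      div_eq_mul_one_div, map_mul, map_mul]
    ext i
    fin_cases i
    · simp [fibreVec]; ring
    · simp [fibreVec]; ring
    · simp [fibreVec]
  rw [heq]
  exact hm

/-- A point of `L` other than `(1 : 0)` is affine. -/
lemma exists_eq_affinePoint_or_mem (ξ : ProjPoint 2 ℚ) :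
    (∃ x, ξ = affinePoint x) ∨ ![1, 0] ∈ ξ.line := by
  by_cases h : ∃ v ∈ ξ.line, v 1 ≠ 0
  · obtain ⟨v, hv, h1⟩ := h
    refine .inl ⟨v 0 / v 1, ProjPoint.eq_of_mem (u := v) (i := 1) h1.isUnit hv ?_⟩
    have heq : v 1 • ![v 0 / v 1, 1] = v := by
      ext i; fin_cases i <;> simp; field_simp
    have hmem : v 1 • ![v 0 / v 1, 1] ∈ (affinePoint (v 0 / v 1)).line :=
      Submodule.smul_mem _ (v 1) (Submodule.subset_span rfl)
    rwa [heq] at hmem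
  · push Not at h
    have h0 : ∃ v ∈ ξ.line, v 0 ≠ 0 := by
      by_contra! h0
      have hle : Ideal.span {r : ℚ | ∃ v ∈ ξ.line, ∃ i, v i = r} ≤ ⊥ := by
        rw [Ideal.span_le]
        rintro _ ⟨v, hv, i, rfl⟩
        fin_cases i
        · exact h0 v hv
        · exact h v hv
      rw [ξ.unimodular] at hle
      exact bot_ne_top (top_le_iff.mp hle)
    obtain ⟨v, hv, h0⟩ := h0
    refine .inr (ξ.mem_line_of_smul_mem h0.isUnit ?_)
    have heq : v 0 • ![1, 0] = v := by
      ext i; fin_cases i <;> simp [h v hv]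
    rwa [heq]

/-- For x ≤ -1 the lower terms are at most (|b₂| + 2|b₄| + |b₆|) x², which 4x³ outweighs. -/
lemma fibreDisc_neg (E : WeierstrassCurve ℚ) {x : ℚ}
    (hx : x < -(|E.b₂| + 2 * |E.b₄| + |E.b₆| + 1)) : fibreDisc E x < 0 := by
  have h2 := abs_nonneg E.b₂
  have h4 := abs_nonneg E.b₄
  have h6 := abs_nonneg E.b₆
  have hx1 : 1 ≤ -x := by linarith
  have hsq : -x ≤ x ^ 2 := by nlinarith
  have e2 : E.b₂ * x ^ 2 ≤ |E.b₂| * x ^ 2 := mul_le_mul_of_nonneg_right (le_abs_self _) (sq_nonneg _)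
  have e4 : E.b₄ * x ≤ |E.b₄| * x ^ 2 := by
    have : E.b₄ * x ≤ |E.b₄| * -x := by nlinarith [neg_abs_le E.b₄]
    exact this.trans (mul_le_mul_of_nonneg_left hsq h4)
  have e6 : E.b₆ ≤ |E.b₆| * x ^ 2 := by nlinarith [le_abs_self E.b₆]
  have hpos : 0 < x ^ 2 := by nlinarith
  have key : (4 * x + (|E.b₂| + 2 * |E.b₄| + |E.b₆|)) * x ^ 2 < 0 :=
    mul_neg_of_neg_of_pos (by linarith) hpos
  unfold fibreDisc
  nlinarith

end SelfTwist

/-! ### The main theorem -/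

open SelfTwist

theorem mainTheorem11 (E : WeierstrassCurve ℚ) (hE : E.IsElliptic) :
    {ξ : SelfTwist.ProjPoint 2 ℚ |
      ¬ ∃ (M : SelfTwist.EllipticModel E ξ) (P : (M.curve⁄ℚ).toAffine.Point),
        M.equiv ℚ (SelfTwist.CurvePoint.ofPoint P) =
          SelfTwist.canonicalSection E ℚ (SelfTwist.const ξ ℚ) ∧
        ¬ IsOfFinAddOrder P}.Finite ∧
    ∃ d : ℚ, ¬ IsSquare d ∧ (SelfTwist.quadraticTwist E d).IsElliptic ∧
      0 < Module.rank ℤ (SelfTwist.quadraticTwist E d).toAffine.Point := by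
  obtain ⟨B, hB⟩ := SelfTwist.exists_not_isOfFinAddOrder E
  have hfin : {x : ℚ | Height.logHeight₁ x ≤ B}.Finite :=
    NumberField.finite_setOfPred_logHeight₁_le ℚ B
  have hP : ∀ x : ℚ, (hx : B < Height.logHeight₁ x) → fibreDisc E x ≠ 0 ∧
      ∃ h : (quadraticTwist E (fibreDisc E x)).toAffine.Nonsingular (fibreDisc E x * x)
        (fibreDisc E x ^ 2 / 2), ¬ IsOfFinAddOrder (WeierstrassCurve.Affine.Point.some _ _ h) := by
    intro x hx
    have hD : fibreDisc E x ≠ 0 := (hB x hx).1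
    have := quadraticTwist_isElliptic (E := E) hD
    have h := WeierstrassCurve.Affine.equation_iff_nonsingular.mp (equation_fibreDisc E x)
    exact ⟨hD, h, (hB x hx).2 _ hD _ _ h (mul_div_cancel_left₀ x hD)⟩
  constructor
  · have hsub : {ξ : ProjPoint 2 ℚ | ![1, 0] ∈ ξ.line}.Subsingleton := fun ξ h ξ' h' =>
      ProjPoint.eq_of_mem (i := 0) isUnit_one h h'
    -- The exceptions lie among (1 : 0) and the finitely many (x : 1) of height at most B; zeros of
    -- the discriminant are among the latter.
    refine (hsub.finite.union (hfin.image affinePoint)).subset fun ξ hξ => ?_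
    rcases exists_eq_affinePoint_or_mem ξ with ⟨x, rfl⟩ | h
    · refine .inr ⟨x, ?_, rfl⟩
      by_contra hx
      obtain ⟨hD, h, hord⟩ := hP x (not_le.mp hx)
      exact hξ ⟨ellipticModel E hD, .some _ _ h, toFibre_eq_canonicalSection E hD h.1, hord⟩
    · exact .inl h
  -- Infinitely many x are negative enough for a negative discriminant, and only finitely many of
  -- them have height at most B.
  · obtain ⟨x, hx, hxB⟩ := ((Set.Iio_infinite (-(|E.b₂| + 2 * |E.b₄| + |E.b₆| + 1))).sdiff
      hfin).nonempty
    obtain ⟨hD, h, hord⟩ := hP x (not_le.mp hxB)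
    refine ⟨fibreDisc E x, fun hs => (fibreDisc_neg E hx).not_ge hs.nonneg,
      quadraticTwist_isElliptic hD, pos_iff_ne_zero.mpr fun h0 => ?_⟩
    obtain ⟨a, ha, ha'⟩ := rank_eq_zero_iff.mp h0 (.some _ _ h)
    exact hord (isOfFinAddOrder_iff_zsmul_eq_zero.mpr ⟨a, ha, ha'⟩)
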